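/- **Setting.** Let $\Sigma$ be a finite alphabet, $V\subset\Sigma^{+}$ a finite vocabulary containing every character, and $D=[r_1,\dots,r_m]$ an ordered list of merge rules $(x,y)\to xy$ with $x,y,xy\in V$; $r_1$ has the highest priority. Applying a rule to a token sequence replaces adjacent occurrences of $x,y$ by $xy$ in one scan from left to right. The tokenization $\mathbb T(s)$ is obtained from the sequence of characters of $s$ by applying $r_1,\dots,r_m$ in this order, once each. For $s\neq\varepsilon$ let $\theta(s)$ be the last token of $\mathbb T(s)$; $\theta(\varepsilon)=\varepsilon$ by convention. A token $u\in V$ is *canonical* if $\mathbb T(u)=[u]$; $\mathcal V$ is the set of canonical tokens, $t$ is the maximum length of a token in $\mathcal V$, and $\tau(s)$ is the longest suffix of $s$ in $\mathcal V$. The *canonical rule* of a canonical token $u$ with $|u|>1$ is the rule $(x,y)$ whose application completes the tokenization of $u$ to $[u]$; put $\mathrm{pre}(u)=x$, $\mathrm{suc}(u)=y$. The *successor forest* has node set $\mathcal V$ and edges $u\to\mathrm{suc}(u)$ ($|u|>1$), with $\mathrm{suc}(u)$ the parent of $u$. $\mathrm{SufSucTree}(\tau)$ is its subgraph induced by the canonical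 suffixes of $\tau$. Traverse the forest in depth-first pre-order, the roots (single characters) in any fixed order and the children of a node from lowest to highest priority of their canonical rules; $\mathrm{dfs\_in}$ and $\mathrm{dfs\_out}$ are the entry and exit times, so that the subtree of $u$ occupies $[\mathrm{dfs\_in}(u),\mathrm{dfs\_out}(u))$. For $u\in\mathcal V$, $|u|>1$, let $I_u=[L_u,R_u)$, where $L_u=\mathrm{dfs\_in}(\mathrm{pre}(u))$ and $R_u=\mathrm{dfs\_in}(v)$ for the first child $v$ of $\mathrm{pre}(u)$ in this order whose canonical rule has priority at least that of $u$, or $R_u=\mathrm{dfs\_out}(\mathrm{pre}(u))$ if there is none. A *centroid search tree* (CST) of $\mathrm{SufSucTree}(\tau)$ is a tree obtained by recursively choosing a centroid $u$ of the current weakly connected component $K$ (each component of $K\setminus\{u\}$ has at most $|K|/2$ nodes); the node of $u$ points to the CST of the component of its parent and, for each child of $u$ in $\mathrm{SufSucTree}(\tau)$, to the CST of that child's component (null if there is none). The children are stored sorted by $L$. **Algorithm.** Precomputed are the Aho–Corasick automaton of $\mathcal V$ (its states are the prefixes of canonical tokens), with each state annotated by itself if it lies in $\mathcal V$ and otherwise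 by the annotation of its suffix link; a CST for each $\tau\in\mathcal V$; and tables of $\mathrm{dfs\_in}$, $L$, $R$ and token lengths. A history query $\mathcal H(\ell)$ returns $\theta$ of the current string with its last $\ell$ characters removed. When $c$ is appended to $s$, the automaton makes one transition, the annotation of the new state is read, and its CST is searched from the root. At a node with centroid $u$: $u$ is valid if $|u|=1$ or $\mathrm{dfs\_in}(\mathcal H(|\mathrm{suc}(u)|))\in I_u$. If $u$ is invalid, go to the CST of the component of the parent of $u$. If $u$ is valid, find by binary search a child $v$ of $u$ in $\mathrm{SufSucTree}(\tau)$ with $\mathrm{dfs\_in}(\mathcal H(|u|))\in I_v$; if it exists go to the CST of its component, otherwise return $u$. The cost is the number of elementary steps: table look-ups, history queries, pointer moves, index arithmetic, comparisons, and appending to the history are one step each. **Theorem.** There is an absolute constant $C$ such that the following holds for all $\Sigma,V,D$ as above. A CST exists for every $\tau\in\mathcal V$, and for every choice of CSTs: 1. The CST of $\tau$ has at most $\lfloor\log_2|\tau|\rfloor+1$ levels. 2. For every string $s$ and character $c$, starting from the automaton state reached by $s$ and with correct history answers, the annotation of the state reached by $sc$ is $\tau(sc)$, the update returns $\theta(sc)$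 and the automaton state reached by $sc$, and it takes at most $C\,(1+\log^2|\tau(sc)|)$ steps. 3. If the history is an array filled by the algorithm itself, then running it from scratch on an input $s$ of length $n$ stores $\theta(p)$ for every prefix $p$ of $s$; processing a further character costs at most $C\,(1+\log^2 t)$ steps, and the whole input costs at most $C\,n\,(1+\log^2 t)$ steps. -/

import Mathlib

/-!
# Byte pair encoding, the successor forest, and the incremental algorithm

Strings and tokens are both lists of characters.
-/

/-! ## Computations with a step count -/

/-- A computation together with the number of elementary steps it takes. -/
structure Cost (β : Type*) where
  val : β
  time : ℕ

namespace Cost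

/-- One elementary step: a table or array access, a history query, following a pointer,
an arithmetic operation on indices, a comparison, or appending to an array. -/
def op {β : Type*} (b : β) : Cost β := ⟨b, 1⟩

/-- A result that needs no further step. -/
def ret {β : Type*} (b : β) : Cost β := ⟨b, 0⟩

/-- Run `m`, then run `f` on its result; the numbers of steps add up. -/
def bind {β γ : Type*} (m : Cost β) (f : β → Cost γ) : Cost γ :=
  ⟨(f m.val).val, m.time + (f m.val).time⟩

end Cost

/-! ## Centroid search trees -/

/-- The shape of a centroid search tree. A node stores its centroid `u`, a pointer `up` to the
search tree of the component of the parent of `u`, the array `child` of the children of `u`,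
and for each of them a pointer `down` to the search tree of its component.
`nil` is the null pointer (the component is empty). -/
inductive CST (α : Type*) where
  | nil : CST α
  | node (u : List α) (up : CST α) (deg : ℕ) (child : Fin deg → List α)
      (down : Fin deg → CST α) : CST α

/-- The number of nodes on a longest downward path. -/
def CST.height {α : Type*} : CST α → ℕ
  | .nil => 0
  | .node _ up _ _ down => max up.height (Finset.univ.sup fun i => (down i).height) + 1

/-! ## Dictionaries and tokenization -/

/-- A finite vocabulary `V ⊆ Σ⁺` that contains every character as an atomic token, and an ordered
list of merge rules `(x, y) → xy` (highest priority first) between tokens. -/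
structure BPE (α : Type*) where
  vocab : Finset (List α)
  rules : List (List α × List α)
  nil_notMem : [] ∉ vocab
  atomic_mem : ∀ c : α, [c] ∈ vocab
  rules_mem : ∀ r ∈ rules, r.1 ∈ vocab ∧ r.2 ∈ vocab ∧ r.1 ++ r.2 ∈ vocab

namespace BPE

variable {α : Type*} [DecidableEq α]

/-- Replace adjacent tokens `x, y` by `xy`, scanning once from left to right. -/
def mergePass (x y : List α) : List (List α) → List (List α)
  | a :: b :: rest =>
      if a = x ∧ b = y then (x ++ y) :: mergePass x y rest
      else a :: mergePass x y (b :: rest)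
  | φ => φ

/-- Start from the sequence of characters of `s` and apply the given rules in order. -/
def applyRules (rs : List (List α × List α)) (s : List α) : List (List α) :=
  rs.foldl (fun φ r => mergePass r.1 r.2 φ) (s.map fun c => [c])

/-- The standard BPE tokenization of `s`. -/
def tokenize (B : BPE α) (s : List α) : List (List α) := applyRules B.rules s

/-- The last token `θ(s)`; for the empty string this is `[]`, the virtual root. -/
def lastToken (B : BPE α) (s : List α) : List α := (B.tokenize s).getLastD []

/-- The normalized vocabulary: the canonical tokens. -/
def canon (B : BPE α) : Finset (List α) := B.vocab.filter fun t => B.tokenize t = [t]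

/-- The maximum length of a canonical token. -/
def maxLen (B : BPE α) : ℕ := B.canon.sup List.length

/-- The longest canonical token that is a suffix of `s` (`[]` for the empty string). -/
def longestSuffixToken (B : BPE α) (s : List α) : List α :=
  (s.tails.find? fun t => decide (t ∈ B.canon)).getD []

/-! ## Canonical rules and the successor forest -/

/-- The index of the canonical rule of a non-atomic canonical token `t`: the rule whose
application completes the tokenization of the string `t` to `[t]`.
A smaller index means a higher priority. -/
def ruleIdx (B : BPE α) (t : List α) : ℕ :=
  ((List.range B.rules.length).find? fun k =>
    decide (applyRules (B.rules.take (k + 1)) t = [t])).getD 0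

/-- The predecessor of a non-atomic canonical token (`[]` for other strings). -/
def pre (B : BPE α) (t : List α) : List α :=
  if t ∈ B.canon ∧ 1 < t.length then (B.rules.getD (B.ruleIdx t) ([], [])).1 else []

/-- The successor of a non-atomic canonical token (`[]` for other strings). -/
def suc (B : BPE α) (t : List α) : List α :=
  if t ∈ B.canon ∧ 1 < t.length then (B.rules.getD (B.ruleIdx t) ([], [])).2 else []

/-- `(u, v)` is an edge of the successor forest: `u` is a non-atomic canonical token and
`v` is its successor. -/
def SucEdge (B : BPE α) (u v : List α) : Prop := u ∈ B.canon ∧ 1 < u.length ∧ B.suc u = v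

instance (B : BPE α) (u v : List α) : Decidable (B.SucEdge u v) := by
  unfold SucEdge; infer_instance

/-- The children of `u` in the successor forest, from lowest to highest priority of their
canonical rules: go through the rules backwards and keep the token produced by the rule
if this is the canonical rule of a child of `u`. -/
def childrenByPriority (B : BPE α) (u : List α) : List (List α) :=
  (List.range B.rules.length).reverse.filterMap fun k =>
    let r := B.rules.getD k ([], [])
    let t := r.1 ++ r.2
    if B.ruleIdx t = k ∧ B.SucEdge t u then some t else none

/-! ## Depth-first linearization and valid intervals -/

/-- Pre-order traversal of the subtree of `u`, cut off below depth `fuel`. -/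
def preorderAux (B : BPE α) : ℕ → List α → List (List α)
  | 0, u => [u]
  | fuel + 1, u => u :: (B.childrenByPriority u).flatMap (preorderAux B fuel)

/-- Pre-order traversal of the whole subtree of `u` (lengths strictly increase from a token to
its children, so the depth of the forest is less than `maxLen`). -/
def preorder (B : BPE α) (u : List α) : List (List α) := B.preorderAux B.maxLen u

/-- Pre-order traversal of the successor forest, where the atomic tokens are visited in the
order given by `order`, a list of all characters. -/
def forestOrder (B : BPE α) (order : List α) : List (List α) :=
  order.flatMap fun c => B.preorder [c]

/-- Entry timestamp. -/
def dfsIn (B : BPE α) (order : List α) (u : List α) : ℕ := (B.forestOrder order).idxOf u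

/-- Exit timestamp: the number of nodes entered once the subtree of `u` is fully explored. -/
def dfsOut (B : BPE α) (order : List α) (u : List α) : ℕ :=
  B.dfsIn order u + (B.preorder u).length

/-- Left end of the valid interval `[L, R)` of a non-atomic canonical token. -/
def intervalL (B : BPE α) (order : List α) (t : List α) : ℕ := B.dfsIn order (B.pre t)

/-- Right end of the valid interval `[L, R)` of a non-atomic canonical token: the entry time of
the first child of `pre t` whose priority is at least that of `t`, or else the exit time of
`pre t`. -/
def intervalR (B : BPE α) (order : List α) (t : List α) : ℕ :=
  match (B.childrenByPriority (B.pre t)).find? fun u => decide (B.ruleIdx u ≤ B.ruleIdx t) with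
  | some u => B.dfsIn order u
  | none => B.dfsOut order (B.pre t)

/-! ## The annotated Aho–Corasick automaton -/

/-- The states are the nodes of the trie of the canonical tokens, i.e. their prefixes. -/
def IsState (B : BPE α) (u : List α) : Prop := ∃ t ∈ B.canon, u <+: t

instance (B : BPE α) (u : List α) : Decidable (B.IsState u) := by
  unfold IsState; infer_instance

/-- The suffix link: the longest proper suffix that is a state (the root `[]` if there is none). -/
def link (B : BPE α) (u : List α) : List α :=
  (u.tails.tail.find? fun w => decide (B.IsState w)).getD []

theorem length_link_lt (B : BPE α) {u : List α} (hu : u ≠ []) :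
    (B.link u).length < u.length := by
  cases u with
  | nil => exact absurd rfl hu
  | cons a l =>
    unfold link
    cases h : ((a :: l).tails.tail.find? fun w => decide (B.IsState w)) with
    | none => simp
    | some w =>
      have hw := List.mem_of_find?_eq_some h
      have hw' : w <:+ l := by simpa using hw
      have := hw'.length_le
      simp only [Option.getD_some, List.length_cons]
      omega

/-- The transition function. -/
def delta (B : BPE α) (u : List α) (c : α) : List α :=
  if B.IsState (u ++ [c]) then u ++ [c]
  else if _h : u = [] then []
  else B.delta (B.link u) c
termination_by u.length
decreasing_by exact B.length_link_lt _h

/-- The annotation of a state: the state itself if it is a canonical token, otherwise the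
annotation of its suffix link (`[]` means that there is no token). -/
def annot (B : BPE α) (u : List α) : List α :=
  if u ∈ B.canon then u
  else if _h : u = [] then []
  else B.annot (B.link u)
termination_by u.length
decreasing_by exact B.length_link_lt _h

/-- The state that the automaton reaches from the root on reading `s`. -/
def acState (B : BPE α) (s : List α) : List α := s.foldl B.delta []

/-! ## Suffix-successor trees and their centroid decompositions -/

/-- The nodes of the suffix-successor tree of `τ`: the canonical tokens that are suffixes of `τ`.
The edges are those of the successor forest. -/
def sufSucTree (B : BPE α) (τ : List α) : Finset (List α) := B.canon.filter fun t => t <:+ τ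

/-- Two nodes of `S` joined by an edge of the successor forest, in either direction. -/
def AdjIn (B : BPE α) (S : Finset (List α)) (a b : List α) : Prop :=
  a ∈ S ∧ b ∈ S ∧ (B.SucEdge a b ∨ B.SucEdge b a)

open Classical in
/-- The weakly connected component of `v` in the subgraph of the successor forest induced by `S`
(empty if `v ∉ S`). -/
noncomputable def component (B : BPE α) (S : Finset (List α)) (v : List α) : Finset (List α) :=
  S.filter fun w => v ∈ S ∧ Relation.ReflTransGen (B.AdjIn S) v w

/-- `u` is a centroid of `K`: the components left after removing `u` have at most half the size
of `K`. -/
def IsCentroid (B : BPE α) (K : Finset (List α)) (u : List α) : Prop :=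
  u ∈ K ∧ ∀ v ∈ K.erase u, 2 * (B.component (K.erase u) v).card ≤ K.card

/-- `T` is a centroid search tree for the component `K` of the suffix-successor tree of `τ`.
At each node, `child` lists the children of the centroid in the whole suffix-successor tree,
sorted by their valid intervals. -/
def IsCST (B : BPE α) (order : List α) (τ : List α) : CST α → Finset (List α) → Prop
  | .nil, K => K = ∅
  | .node u up _ child down, K =>
      B.IsCentroid K u ∧
      IsCST B order τ up (B.component (K.erase u) (B.suc u)) ∧
      (∀ v, v ∈ Set.range child ↔ v ∈ B.sufSucTree τ ∧ B.SucEdge v u) ∧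
      StrictMono (fun i => B.intervalL order (child i)) ∧
      ∀ i, IsCST B order τ (down i) (B.component (K.erase u) (child i))

/-- A table that holds a centroid search tree of the suffix-successor tree of each canonical
token. -/
def IsCSTTable (B : BPE α) (order : List α) (cst : List α → CST α) : Prop :=
  ∀ τ ∈ B.canon, B.IsCST order τ (cst τ) (B.sufSucTree τ)

/-! ## The incremental algorithm

The precomputed tables are `delta`, `annot`, `cst`, `dfsIn`, `intervalL`, `intervalR`, and the
lengths of the tokens and of their successors. -/

open Cost

/-- Binary search in a sorted array: the first index in `[lo, hi)` whose key is larger than `x`,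
or `hi` if there is none. -/
def bsearch {n : ℕ} (key : Fin n → ℕ) (x lo hi : ℕ) (hn : hi ≤ n) : Cost ℕ :=
  (op (decide (lo < hi))).bind fun _ =>
  if h : lo < hi then
    (op ((lo + hi) / 2)).bind fun _ =>
    (op (key ⟨(lo + hi) / 2, by omega⟩)).bind fun k =>
    (op (decide (k ≤ x))).bind fun le =>
    if le then bsearch key x ((lo + hi) / 2 + 1) hi hn
    else bsearch key x lo ((lo + hi) / 2) (by omega)
  else ret lo
termination_by hi - lo
decreasing_by all_goals omega

/-- Does the timestamp `x` lie in the valid interval of `t`? -/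
def inInterval (B : BPE α) (order : List α) (t : List α) (x : ℕ) : Cost Bool :=
  (op (B.intervalL order t)).bind fun l =>
  (op (B.intervalR order t)).bind fun r =>
  (op (decide (l ≤ x))).bind fun b₁ =>
  (op (decide (x < r))).bind fun b₂ =>
  op (b₁ && b₂)

/-- The validity check at a centroid `u`: atomic tokens are valid; otherwise query the history
at `|suc u|` and test the interval of `u`. -/
def checkNode (B : BPE α) (order : List α) (H : ℕ → List α) (u : List α) : Cost Bool :=
  (op u.length).bind fun len =>
  (op (decide (len ≤ 1))).bind fun atomic =>
  if atomic then ret true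
  else
    (op (B.suc u).length).bind fun ℓ =>
    (op (H ℓ)).bind fun k =>
    (op (B.dfsIn order k)).bind fun x =>
    B.inInterval order u x

/-- Look for a valid child of `u`: query the history at `|u|`, find by binary search the last
child whose interval starts at or before the timestamp, and test it. -/
def findChild (B : BPE α) (order : List α) (H : ℕ → List α) (u : List α) {deg : ℕ}
    (child : Fin deg → List α) : Cost (Option (Fin deg)) :=
  (op u.length).bind fun ℓ =>
  (op (H ℓ)).bind fun k =>
  (op (B.dfsIn order k)).bind fun x =>
  (bsearch (fun i => B.intervalL order (child i)) x 0 deg le_rfl).bind fun j =>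
  (op (decide (0 < j))).bind fun _ =>
  -- the second condition always holds, as `j ≤ deg`
  if h : 0 < j ∧ j - 1 < deg then
    (op (child ⟨j - 1, h.2⟩)).bind fun v =>
    (B.inInterval order v x).bind fun ok =>
    if ok then ret (some ⟨j - 1, h.2⟩) else ret none
  else ret none

/-- The search down a centroid search tree with history interface `H`. An invalid centroid sends
the search upwards, a valid child of a valid centroid sends it to the component of that child,
and a valid centroid without valid children is the answer. -/
def search (B : BPE α) (order : List α) (H : ℕ → List α) : CST α → Cost (List α)
  | .nil => ret []
  | .node u up _ child down =>
      (B.checkNode order H u).bind fun valid =>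
      if valid then
        (B.findChild order H u child).bind fun next =>
        match next with
        | none => ret u
        | some i => (op i).bind fun i => search B order H (down i)
      else (op ()).bind fun _ => search B order H up

/-- Process one more character `c`: from the automaton state `q` before reading `c`, compute the
new state and the new last token. -/
def update (B : BPE α) (order : List α) (cst : List α → CST α) (H : ℕ → List α)
    (q : List α) (c : α) : Cost (List α × List α) :=
  (op (B.delta q c)).bind fun q' =>
  (op (B.annot q')).bind fun τ =>
  (op (cst τ)).bind fun T =>
  (B.search order H T).bind fun θ =>
  ret (q', θ)

/-- The data kept by the algorithm between two characters: the automaton state, and an array that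
holds at index `i` the last token of the prefix of length `i` of the input read so far. -/
structure Memory (α : Type*) where
  state : List α
  hist : Array (List α)

/-- One round: update with the array as the history, and record the new last token. If the string
after appending `c` has length `m`, then `hist` has size `m` and removing `ℓ` characters
from the end gives the prefix of length `m - ℓ`. -/
def step (B : BPE α) (order : List α) (cst : List α → CST α) (M : Memory α) (c : α) :
    Cost (Memory α) :=
  (B.update order cst (fun ℓ => M.hist.getD (M.hist.size - ℓ) []) M.state c).bind fun r =>
  (op (M.hist.push r.2)).bind fun hist =>
  ret ⟨r.1, hist⟩

/-- Process a string character by character. -/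
def runFrom (B : BPE α) (order : List α) (cst : List α → CST α) :
    Memory α → List α → Cost (Memory α)
  | M, [] => ret M
  | M, c :: s => (B.step order cst M c).bind fun M' => runFrom B order cst M' s

/-- Process a string from scratch. -/
def run (B : BPE α) (order : List α) (cst : List α → CST α) (s : List α) : Cost (Memory α) :=
  B.runFrom order cst ⟨[], #[[]]⟩ s

/-- `H` answers the history queries for the string `w`: for `0 < ℓ < |w|` it returns the last token
of the prefix obtained from `w` by removing `ℓ` characters from the end. -/
def IsHistory (B : BPE α) (w : List α) (H : ℕ → List α) : Prop :=
  ∀ ℓ, 0 < ℓ → ℓ < w.length → H ℓ = B.lastToken (w.take (w.length - ℓ))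

end BPE

namespace BPE

variable {α : Type*} [DecidableEq α]

/-! ## Single merge passes -/

/-! Follow the last token of a fixed string through the rounds. It either stays or is replaced by
one of its children in the successor forest (`Ends.succ`). Hence the tokens that are ever last are
exactly the ancestors of the final one, itself included (`Ends.lastToken_desc`, `Desc.exists_ends`).
Finding `θ(sc)` thus amounts to deciding which canonical suffixes of `sc` are ancestors of `θ(sc)`.

Ancestry can be read off a shorter prefix. Let `u = xy` be canonical with canonical rule `(x, y)`.
At the end of `s y` the token `u` forms in the round of that rule if and only if the same round, run
on `s` alone, leaves `x` last (`ends_append_suc_iff`). In terms of `θ(s)`, this says that `θ(s) = x`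
or that `θ(s)` lies below a child of `x` whose rule comes strictly later (`ends_pre_iff`). Since
children are visited from lowest to highest priority, these nodes fill a contiguous stretch of the
preorder starting at `x`. The condition is therefore membership of one timestamp in an interval
(`inInterval_iff`).

The canonical suffixes of `τ(sc)` form a connected tree with at most `|τ(sc)|` nodes, and `θ(sc)` is
one of them. A centroid `u` that is not an ancestor of `θ(sc)` sends the search to the component of
its parent; otherwise `θ(sc)` is `u` or lies below exactly one child. Because no sibling interval
starts inside another (`not_inInterval_intervalL`), binary search on left ends finds that child.
`IsCST.search_val` carries the invariant that the current component contains `θ(sc)`. Components at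
least halve at every level (`IsCST.height_le`), and each level costs one binary search, which gives
the squared logarithm. -/

theorem mergePass_flatten (x y : List α) (φ : List (List α)) :
    (mergePass x y φ).flatten = φ.flatten := by
  fun_induction mergePass x y φ with
  | case1 a b rest h ih => simp [ih, h.1, h.2]
  | case2 a b rest h ih => simpa using ih
  | case3 φ h => rfl

theorem mergePass_singleton (x y a : List α) : mergePass x y [a] = [a] := by
  simp [mergePass]

theorem mergePass_ne_nil (x y : List α) {φ : List (List α)} (h : φ ≠ []) :
    mergePass x y φ ≠ [] := by
  unfold mergePass
  split
  · split <;> simp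
  · exact h

/-- A boundary that is present after a merge pass was present before. -/
theorem mergePass_eq_append {x y : List α} {φ C D : List (List α)}
    (h : mergePass x y φ = C ++ D) :
    ∃ A B, φ = A ++ B ∧ mergePass x y A = C ∧ mergePass x y B = D := by
  induction φ using mergePass.induct x y generalizing C with
  | case1 a b rest hab ih =>
    rw [mergePass, if_pos hab] at h
    cases C with
    | nil => exact ⟨[], a :: b :: rest, rfl, rfl, by rw [mergePass, if_pos hab]; simpa using h⟩
    | cons c C =>
      simp only [List.cons_append, List.cons.injEq] at h
      obtain ⟨A, B, rfl, rfl, rfl⟩ := ih h.2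
      exact ⟨a :: b :: A, B, rfl, by rw [mergePass, if_pos hab, h.1], rfl⟩
  | case2 a b rest hab ih =>
    have h₀ := h
    rw [mergePass, if_neg hab] at h
    cases C with
    | nil => exact ⟨[], a :: b :: rest, rfl, rfl, by simpa using h₀⟩
    | cons c C =>
      simp only [List.cons_append, List.cons.injEq] at h
      obtain ⟨A, B, hAB, rfl, rfl⟩ := ih h.2
      refine ⟨a :: A, B, by simp [hAB], ?_, rfl⟩
      rw [← h.1]
      cases A with
      | nil => simp [mergePass]
      | cons d A =>
        simp only [List.cons_append, List.cons.injEq] at hAB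
        rw [mergePass, if_neg]
        rw [← hAB.1]; exact hab
  | case3 φ hφ =>
    have : mergePass x y φ = φ := by
      unfold mergePass
      split
      · exact absurd rfl (hφ _ _ _)
      · rfl
    rw [this] at h
    subst h
    match C, D, hφ with
    | [], D, _ => exact ⟨[], D, rfl, rfl, by simpa using this⟩
    | [c], [], _ => exact ⟨[c], [], rfl, by simp [mergePass], rfl⟩
    | [c], d :: D, hφ => exact absurd rfl (hφ c d D)
    | c :: c' :: C, D, hφ => exact absurd rfl (hφ c c' (C ++ D))

/-- A merge pass treats two parts separately, unless it leaves an `x` at the end of the first part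
and the second part starts with `y`; then these two tokens are merged. -/
theorem mergePass_append {x y : List α} (hy : y ≠ []) (A B : List (List α)) :
    (¬ (∃ C B', mergePass x y A = C ++ [x] ∧ B = y :: B') →
      mergePass x y (A ++ B) = mergePass x y A ++ mergePass x y B) ∧
    ∀ C B', mergePass x y A = C ++ [x] → B = y :: B' →
      mergePass x y (A ++ B) = C ++ (x ++ y) :: mergePass x y B' := by
  -- A token `xy` just produced at the end of `A` must not pass for an `x` that is still free to
  -- merge with `y`.
  have hne : x ++ y ≠ x := by simpa using hy
  induction A using mergePass.induct x y with
  | case1 a b rest hab ih =>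
    simp only [List.cons_append]
    rw [mergePass, if_pos hab, mergePass, if_pos hab]
    refine ⟨fun h => ?_, fun C B' hC hB => ?_⟩
    · rw [ih.1, List.cons_append]
      rintro ⟨C, B', h1, h2⟩
      exact h ⟨(x ++ y) :: C, B', by simp [h1], h2⟩
    · cases C with
      | nil => simp [hne] at hC
      | cons c C =>
        simp only [List.cons_append, List.cons.injEq] at hC
        rw [ih.2 C B' hC.2 hB, ← hC.1]; rfl
  | case2 a b rest hab ih =>
    simp only [List.cons_append] at ih ⊢
    rw [mergePass, if_neg hab, mergePass, if_neg hab]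
    refine ⟨fun h => ?_, fun C B' hC hB => ?_⟩
    · rw [ih.1, List.cons_append]
      rintro ⟨C, B', h1, h2⟩
      exact h ⟨a :: C, B', by simp [h1], h2⟩
    · cases C with
      | nil =>
        simp only [List.nil_append, List.cons.injEq] at hC
        exact absurd hC.2 (mergePass_ne_nil x y (by simp))
      | cons c C =>
        simp only [List.cons_append, List.cons.injEq] at hC
        rw [ih.2 C B' hC.2 hB, ← hC.1]; rfl
  | case3 φ hφ =>
    match φ, hφ with
    | [], _ => exact ⟨fun _ => by simp [mergePass], fun C B' h => by simp [mergePass] at h⟩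
    | [a], _ =>
      rw [mergePass_singleton]
      refine ⟨fun h => ?_, fun C B' hC hB => ?_⟩
      · cases B with
        | nil => simp [mergePass]
        | cons b B =>
          simp only [List.cons_append, List.nil_append]
          rw [mergePass, if_neg]
          rintro ⟨rfl, rfl⟩
          exact h ⟨[], B, rfl, rfl⟩
      · have : C = [] ∧ a = x := by
          cases C with
          | nil => simpa using hC
          | cons c C => simp at hC
        obtain ⟨rfl, rfl⟩ := this
        subst hB
        simp [mergePass]
    | a :: b :: r, hφ => exact absurd rfl (hφ a b r)

/-- The last token after a merge pass is the old one or the result of merging the last two. -/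
theorem mergePass_concat (x y : List α) (E : List (List α)) (w : List α) :
    (∃ F, mergePass x y (E ++ [w]) = F ++ [w]) ∨
    ∃ F, E = F ++ [x] ∧ w = y ∧ mergePass x y (E ++ [w]) = mergePass x y F ++ [x ++ y] := by
  obtain ⟨F, z, hF⟩ : ∃ F z, mergePass x y (E ++ [w]) = F ++ [z] := by
    rcases List.eq_nil_or_concat (mergePass x y (E ++ [w])) with h | ⟨F, z, h⟩
    · exact absurd h (mergePass_ne_nil x y (by simp))
    · exact ⟨F, z, by simpa using h⟩
  obtain ⟨A, B, hAB, hA, hB⟩ := mergePass_eq_append hF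
  rcases List.eq_nil_or_concat B with rfl | ⟨B', b, hB'⟩
  · simp [mergePass] at hB
  · rw [List.concat_eq_append] at hB'
    subst hB'
    rw [← List.append_assoc] at hAB
    obtain ⟨rfl, hw⟩ := List.append_inj' hAB rfl
    obtain rfl : w = b := by simpa using hw
    match B', hB with
    | [], hB =>
      left
      refine ⟨F, ?_⟩
      rw [hF, ← hB]
      simp [mergePass]
    | [c], hB =>
      simp only [List.cons_append, List.nil_append] at hB
      rw [mergePass] at hB
      split_ifs at hB with hc
      · obtain ⟨rfl, rfl⟩ := hc
        right
        refine ⟨A, rfl, rfl, ?_⟩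
        rw [hF, hA]
        simp [mergePass] at hB
        simp [hB]
      · simp [mergePass] at hB
    | c :: d :: B', hB =>
      exfalso
      -- One pass joins at most two tokens into one, so three or more tokens cannot collapse to a
      -- single one.
      have : 1 < (mergePass x y (c :: d :: (B' ++ [w]))).length := by
        rw [mergePass]
        split_ifs
        · have := List.length_pos_iff.2 (mergePass_ne_nil x y (φ := B' ++ [w]) (by simp))
          simp only [List.length_cons]; omega
        · have := List.length_pos_iff.2 (mergePass_ne_nil x y (φ := d :: (B' ++ [w])) (by simp))
          simp only [List.length_cons]; omega
      simp only [List.cons_append] at hB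
      simp [hB] at this

/-! ## Partial tokenizations -/

/-- The token sequence of `s` after the first `k` rules. -/
def seq (B : BPE α) (k : ℕ) (s : List α) : List (List α) := applyRules (B.rules.take k) s

variable {B : BPE α}

theorem seq_zero (s : List α) : B.seq 0 s = s.map fun c => [c] := by
  simp [seq, applyRules]

theorem seq_succ {k : ℕ} (hk : k < B.rules.length) (s : List α) :
    B.seq (k + 1) s = mergePass B.rules[k].1 B.rules[k].2 (B.seq k s) := by
  simp only [seq, applyRules]
  rw [List.take_succ_eq_append_getElem hk, List.foldl_append]
  rfl

theorem seq_succ_of_le {k : ℕ} (hk : B.rules.length ≤ k) (s : List α) :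
    B.seq (k + 1) s = B.seq k s := by
  simp only [seq]
  rw [List.take_of_length_le hk, List.take_of_length_le (by omega)]

theorem seq_length (s : List α) : B.seq B.rules.length s = B.tokenize s := by
  simp [seq, tokenize]

theorem snd_ne_nil {α : Type*} {B : BPE α} {k : ℕ} (hk : k < B.rules.length) :
    B.rules[k].2 ≠ [] := fun h =>
  B.nil_notMem (h ▸ (B.rules_mem _ (List.getElem_mem hk)).2.1)

theorem seq_flatten (k : ℕ) (s : List α) : (B.seq k s).flatten = s := by
  induction k with
  | zero =>
    rw [seq_zero]
    induction s with
    | nil => rfl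
    | cons a s ih => simpa using ih
  | succ k ih =>
    by_cases hk : k < B.rules.length
    · rw [seq_succ hk, mergePass_flatten, ih]
    · rw [seq_succ_of_le (by omega), ih]

theorem seq_ne_nil (k : ℕ) {s : List α} (hs : s ≠ []) : B.seq k s ≠ [] := fun h =>
  hs (by simpa [h] using (B.seq_flatten k s).symm)

theorem seq_nil (k : ℕ) : B.seq k [] = [] := by
  induction k with
  | zero => simp [seq_zero]
  | succ k ih =>
    by_cases hk : k < B.rules.length
    · rw [seq_succ hk, ih]; rfl
    · rw [seq_succ_of_le (by omega), ih]

theorem nil_notMem_seq (k : ℕ) (s : List α) : [] ∉ B.seq k s := by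
  induction k with
  | zero => simp [seq_zero]
  | succ k ih =>
    by_cases hk : k < B.rules.length
    · rw [seq_succ hk]
      generalize B.seq k s = φ at ih
      have := snd_ne_nil hk
      fun_induction mergePass B.rules[k].1 B.rules[k].2 φ <;> simp_all
    · rwa [seq_succ_of_le (by omega)]

/-- The tokens produced so far are in the vocabulary. -/
theorem mem_vocab_of_mem_seq {k : ℕ} {s u : List α} (h : u ∈ B.seq k s) : u ∈ B.vocab := by
  induction k generalizing u with
  | zero =>
    rw [seq_zero, List.mem_map] at h
    obtain ⟨c, -, rfl⟩ := h
    exact B.atomic_mem c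
  | succ k ih =>
    by_cases hk : k < B.rules.length
    · rw [seq_succ hk] at h
      generalize B.seq k s = φ at ih h
      have := (B.rules_mem _ (List.getElem_mem hk)).2.2
      fun_induction mergePass B.rules[k].1 B.rules[k].2 φ <;> grind
    · rw [seq_succ_of_le (by omega)] at h
      exact ih h

/-- The parts of a token sequence are the token sequences of the parts. -/
theorem seq_eq_append {k : ℕ} {s : List α} {C D : List (List α)} (h : B.seq k s = C ++ D) :
    C = B.seq k C.flatten ∧ D = B.seq k D.flatten ∧ s = C.flatten ++ D.flatten := by
  have hs : s = C.flatten ++ D.flatten := by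
    rw [← List.flatten_append, ← h, seq_flatten]
  refine ⟨?_, ?_, hs⟩ <;>
  · clear hs
    induction k generalizing C D with
    | zero =>
      rw [seq_zero, List.map_eq_append_iff] at h
      obtain ⟨l₁, l₂, -, rfl, rfl⟩ := h
      have hf (l : List α) : (l.map fun c => [c]).flatten = l := by
        rw [← seq_zero (B := B), seq_flatten]
      simp only [hf, seq_zero]
    | succ k ih =>
      by_cases hk : k < B.rules.length
      · rw [seq_succ hk] at h
        obtain ⟨A, E, hAE, rfl, rfl⟩ := mergePass_eq_append h
        rw [mergePass_flatten, seq_succ hk, ← ih hAE]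
      · rw [seq_succ_of_le (by omega)] at h ⊢
        exact ih h

/-- After the first `k` rules no merge has crossed the boundary between `a` and `b`. -/
def Splits (B : BPE α) (k : ℕ) (a b : List α) : Prop :=
  B.seq k (a ++ b) = B.seq k a ++ B.seq k b

theorem splits_zero (a b : List α) : B.Splits 0 a b := by simp [Splits, seq_zero]

/-- Merging only deletes boundaries, so one that survives round `k` was there before it;
`mergePass_eq_append` recovers the two halves. -/
theorem Splits.pred {k : ℕ} {a b : List α} (h : B.Splits (k + 1) a b) : B.Splits k a b := by
  by_cases hk : k < B.rules.length
  · unfold Splits at h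
    rw [seq_succ hk] at h
    obtain ⟨A, E, hAE, hA, hE⟩ := mergePass_eq_append h
    have hA' : A.flatten = a := by
      rw [← mergePass_flatten B.rules[k].1 B.rules[k].2, hA, seq_flatten]
    have hE' : E.flatten = b := by
      rw [← mergePass_flatten B.rules[k].1 B.rules[k].2, hE, seq_flatten]
    obtain ⟨h1, h2, -⟩ := seq_eq_append hAE
    rw [hA'] at h1
    rw [hE'] at h2
    rw [Splits, hAE, ← h1, ← h2]
  · unfold Splits at h ⊢
    simpa only [seq_succ_of_le (Nat.le_of_not_lt hk)] using h

theorem Splits.mono {j k : ℕ} {a b : List α} (h : B.Splits k a b) (hjk : j ≤ k) :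
    B.Splits j a b := by
  induction hjk with
  | refl => exact h
  | step _ ih => exact ih h.pred

theorem splits_of_seq_eq_append {k : ℕ} {s : List α} {C D : List (List α)}
    (h : B.seq k s = C ++ D) : B.Splits k C.flatten D.flatten := by
  obtain ⟨h1, h2, rfl⟩ := seq_eq_append h
  rw [Splits, ← h1, ← h2, h]

/-- The last token of `s` after the first `k` rules is `u`. -/
def Ends (B : BPE α) (k : ℕ) (s u : List α) : Prop := ∃ E, B.seq k s = E ++ [u]

theorem exists_ends (k : ℕ) {s : List α} (hs : s ≠ []) : ∃ u, B.Ends k s u := by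
  rcases List.eq_nil_or_concat (B.seq k s) with h | ⟨F, z, h⟩
  · exact absurd h (seq_ne_nil k hs)
  · exact ⟨z, F, by simpa using h⟩

theorem Ends.unique {k : ℕ} {s u v : List α} (hu : B.Ends k s u) (hv : B.Ends k s v) : u = v := by
  obtain ⟨E, hE⟩ := hu
  obtain ⟨F, hF⟩ := hv
  rw [hE] at hF
  simpa using (List.append_inj' hF rfl).2

theorem ends_iff_lastToken {s u : List α} (hs : s ≠ []) :
    B.Ends B.rules.length s u ↔ B.lastToken s = u := by
  have key : ∀ w, B.Ends B.rules.length s w → B.lastToken s = w := by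
    rintro w ⟨E, hE⟩
    rw [lastToken, ← seq_length, hE]
    simp
  refine ⟨key u, ?_⟩
  rintro rfl
  obtain ⟨w, hw⟩ := exists_ends B.rules.length hs
  rwa [key w hw]

/-- The boundary before the last token is still intact, so both sides have evolved independently up
to now. This reduces statements about the end of `s` to statements about the token alone. -/
theorem Ends.decomp {k : ℕ} {s u : List α} (h : B.Ends k s u) :
    ∃ e, s = e ++ u ∧ B.Splits k e u ∧ B.seq k u = [u] := by
  obtain ⟨E, hE⟩ := h
  obtain ⟨-, h2, h3⟩ := seq_eq_append hE
  have h4 := splits_of_seq_eq_append hE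
  simp only [List.flatten_cons, List.flatten_nil, List.append_nil] at h2 h3 h4
  exact ⟨_, h3, h4, h2.symm⟩

theorem Splits.ends {k : ℕ} {e u w : List α} (h : B.Splits k e u) (hw : B.Ends k u w) :
    B.Ends k (e ++ u) w := by
  obtain ⟨E, hE⟩ := hw
  exact ⟨B.seq k e ++ E, by rw [h, hE, List.append_assoc]⟩

theorem Splits.ends_iff {k : ℕ} {e u w : List α} (h : B.Splits k e u) (hu : u ≠ []) :
    B.Ends k (e ++ u) w ↔ B.Ends k u w := by
  refine ⟨fun hw => ?_, h.ends⟩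
  obtain ⟨w', hw'⟩ := exists_ends (B := B) k hu
  rwa [hw.unique (h.ends hw')]

theorem ends_self {k : ℕ} {u : List α} (h : B.seq k u = [u]) : B.Ends k u u := ⟨[], by simpa⟩

/-- Once a string has become a single token, it remains one. -/
theorem seq_singleton_mono {j k : ℕ} {u : List α} (h : B.seq j u = [u]) (hjk : j ≤ k) :
    B.seq k u = [u] := by
  induction hjk with
  | refl => exact h
  | @step k _ ih =>
    by_cases hk : k < B.rules.length
    · rw [Nat.succ_eq_add_one, seq_succ hk, ih, mergePass_singleton]
    · rw [Nat.succ_eq_add_one, seq_succ_of_le (by omega), ih]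

/-- Which boundaries disappear in one round. -/
theorem Splits.succ_iff {k : ℕ} (hk : k < B.rules.length) {a b : List α} (h : B.Splits k a b) :
    B.Splits (k + 1) a b ↔
      ¬ (B.Ends (k + 1) a B.rules[k].1 ∧ ∃ F, B.seq k b = B.rules[k].2 :: F) := by
  -- The left part is inspected after the round and the right part before it: the scan finishes `a`
  -- first and may already have consumed its final `x`. This matters when `x = y`.
  have key := mergePass_append (x := B.rules[k].1) (snd_ne_nil hk) (B.seq k a) (B.seq k b)
  rw [← h, ← seq_succ hk, ← seq_succ hk, ← seq_succ hk] at key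
  constructor
  · rintro hs ⟨⟨E, hE⟩, F, hF⟩
    have h1 := key.2 E F hE hF
    rw [hs, hE, List.append_assoc] at h1
    have := List.append_cancel_left h1
    simp [snd_ne_nil hk] at this
  · intro hn
    refine key.1 ?_
    rintro ⟨C, F, hC, hF⟩
    exact hn ⟨⟨C, hC⟩, F, hF⟩

theorem Splits.merge {k : ℕ} (hk : k < B.rules.length) {a b : List α} (h : B.Splits k a b)
    {E F : List (List α)} (hE : B.seq (k + 1) a = E ++ [B.rules[k].1])
    (hF : B.seq k b = B.rules[k].2 :: F) :
    B.seq (k + 1) (a ++ b) =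
      E ++ (B.rules[k].1 ++ B.rules[k].2) :: mergePass B.rules[k].1 B.rules[k].2 F := by
  have key := mergePass_append (x := B.rules[k].1) (snd_ne_nil hk) (B.seq k a) (B.seq k b)
  rw [← h, ← seq_succ hk, ← seq_succ hk, ← seq_succ hk] at key
  exact key.2 E F hE hF

/-! ## Canonical tokens -/

/-- A one-token sequence is immune to later rules, so it does not matter when the collapse happens.
This makes the last tokens of intermediate rounds nodes of the forest. -/
theorem mem_canon_of_seq {k : ℕ} {u : List α} (h : B.seq k u = [u]) : u ∈ B.canon := by
  rw [canon, Finset.mem_filter]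
  refine ⟨mem_vocab_of_mem_seq (k := k) (s := u) (by simp [h]), ?_⟩
  rcases le_total k B.rules.length with hk | hk
  · rw [← seq_length]
    exact seq_singleton_mono h hk
  · rw [seq, List.take_of_length_le hk] at h
    exact h

theorem seq_of_mem_canon {u : List α} (h : u ∈ B.canon) : B.seq B.rules.length u = [u] := by
  rw [seq_length]
  exact (Finset.mem_filter.1 h).2

theorem ne_nil_of_mem_canon {u : List α} (h : u ∈ B.canon) : u ≠ [] := by
  rintro rfl
  exact B.nil_notMem (Finset.mem_filter.1 h).1

theorem lastToken_of_mem_canon {u : List α} (h : u ∈ B.canon) : B.lastToken u = u :=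
  (ends_iff_lastToken (ne_nil_of_mem_canon h)).1 (ends_self (seq_of_mem_canon h))

theorem Ends.mem_canon {k : ℕ} {s u : List α} (h : B.Ends k s u) : u ∈ B.canon := by
  obtain ⟨_, -, -, h⟩ := h.decomp
  exact mem_canon_of_seq h

theorem lastToken_mem_canon {s : List α} (hs : s ≠ []) : B.lastToken s ∈ B.canon :=
  ((ends_iff_lastToken hs).2 rfl).mem_canon

theorem lastToken_suffix (s : List α) : B.lastToken s <:+ s := by
  rcases eq_or_ne s [] with rfl | hs
  · simp [lastToken, ← seq_length, seq_nil]
  · obtain ⟨e, he, -⟩ := ((ends_iff_lastToken (B := B) hs).2 rfl).decomp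
    exact ⟨e, he.symm⟩

/-- The data of the canonical rule. -/
theorem canonical_rule {u : List α} (hu : u ∈ B.canon) (h1 : 1 < u.length) :
    ∃ hk : B.ruleIdx u < B.rules.length,
      B.rules[B.ruleIdx u].1 = B.pre u ∧ B.rules[B.ruleIdx u].2 = B.suc u ∧
      B.seq (B.ruleIdx u) u = [B.pre u, B.suc u] ∧ B.seq (B.ruleIdx u + 1) u = [u] ∧
      ∀ j, B.seq j u = [u] → B.ruleIdx u < j := by
  have h0 : B.seq 0 u ≠ [u] := fun h => by
    have := congrArg List.length h
    simp [seq_zero] at this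
    omega
  have hm := seq_of_mem_canon hu
  have hpos : B.rules.length ≠ 0 := fun h => h0 (by rwa [h] at hm)
  obtain ⟨k, hk⟩ : ∃ k, ((List.range B.rules.length).find? fun k =>
      decide (applyRules (B.rules.take (k + 1)) u = [u])) = some k := by
    rw [← Option.isSome_iff_exists, List.find?_isSome]
    refine ⟨B.rules.length - 1, by simp; omega, ?_⟩
    rw [Nat.sub_add_cancel (by omega)]
    simpa [seq] using hm
  have hidx : B.ruleIdx u = k := by rw [ruleIdx, hk]; rfl
  rw [List.find?_range_eq_some] at hk
  obtain ⟨h2, h3, h4⟩ := hk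
  replace h3 : k < B.rules.length := by simpa using h3
  replace h2 : B.seq (k + 1) u = [u] := by simpa [seq] using h2
  have hfirst : ∀ j, B.seq j u = [u] → k < j := by
    intro j hj
    by_contra hjk
    cases j with
    | zero => exact h0 hj
    | succ j =>
      have := h4 j (by omega)
      simp only [seq] at hj
      simp [hj] at this
  have hpre : B.pre u = B.rules[k].1 := by
    rw [pre, if_pos ⟨hu, h1⟩, hidx, List.getD_eq_getElem _ _ h3]
  have hsuc : B.suc u = B.rules[k].2 := by
    rw [suc, if_pos ⟨hu, h1⟩, hidx, List.getD_eq_getElem _ _ h3]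
  have hk' : B.seq k u ≠ [u] := fun h => lt_irrefl _ (hfirst k h)
  subst hidx
  refine ⟨h3, hpre.symm, hsuc.symm, ?_, h2, hfirst⟩
  obtain ⟨w, E, hE⟩ := exists_ends (B := B) (B.ruleIdx u) (ne_nil_of_mem_canon hu)
  have h5 := h2
  rw [seq_succ h3, hE] at h5
  -- If the deciding pass kept its last token, that token would be all of `u` and the collapse would
  -- have come earlier, against minimality. So the pass merged the last two tokens, and there is no
  -- room for anything before them.
  rcases mergePass_concat B.rules[B.ruleIdx u].1 B.rules[B.ruleIdx u].2 E w with
    ⟨F, hF⟩ | ⟨F, rfl, rfl, hF⟩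
  · rw [h5] at hF
    obtain ⟨-, hw⟩ := List.append_inj' (s₁ := []) hF rfl
    obtain rfl : u = w := by simpa using hw
    have := seq_flatten (B := B) (B.ruleIdx u) u
    rw [hE] at this
    simp only [List.flatten_append, List.flatten_cons, List.flatten_nil, List.append_nil] at this
    replace this : E.flatten = [] := List.append_cancel_right (this.trans (List.nil_append u).symm)
    have hE' : E = [] := by
      rcases E with _ | ⟨a, E⟩
      · rfl
      · have ha : a = [] := by
          rw [List.flatten_cons, List.append_eq_nil_iff] at this; exact this.1
        exact absurd (by simp [hE, ha]) (nil_notMem_seq (B := B) (B.ruleIdx u) u)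
    rw [hE'] at hE
    exact absurd hE hk'
  · rw [h5] at hF
    have hl := congrArg List.length hF
    simp only [List.length_append, List.length_cons, List.length_nil] at hl
    have hF0 : F = [] := by
      by_contra hF0
      have := List.length_pos_iff.2
        (mergePass_ne_nil B.rules[B.ruleIdx u].1 B.rules[B.ruleIdx u].2 hF0)
      omega
    rw [hE, hF0, hpre, hsuc]; rfl

/-! ## The successor forest -/

theorem pre_append_suc {u : List α} (hu : u ∈ B.canon) (h1 : 1 < u.length) :
    B.pre u ++ B.suc u = u := by
  obtain ⟨-, -, -, h, -⟩ := canonical_rule hu h1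
  simpa [h] using seq_flatten (B := B) (B.ruleIdx u) u

theorem splits_pre_suc {u : List α} (hu : u ∈ B.canon) (h1 : 1 < u.length) :
    B.Splits (B.ruleIdx u) (B.pre u) (B.suc u) ∧
      B.seq (B.ruleIdx u) (B.pre u) = [B.pre u] ∧
      B.seq (B.ruleIdx u) (B.suc u) = [B.suc u] := by
  obtain ⟨-, -, -, h, -⟩ := canonical_rule hu h1
  have h2 : B.seq (B.ruleIdx u) u = [B.pre u] ++ [B.suc u] := h
  have h3 := seq_eq_append h2
  have h4 := splits_of_seq_eq_append h2
  simp only [List.flatten_cons, List.flatten_nil, List.append_nil] at h3 h4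
  exact ⟨h4, h3.1.symm, h3.2.1.symm⟩

theorem pre_mem_canon {u : List α} (hu : u ∈ B.canon) (h1 : 1 < u.length) : B.pre u ∈ B.canon :=
  mem_canon_of_seq (splits_pre_suc hu h1).2.1

theorem suc_mem_canon {u : List α} (hu : u ∈ B.canon) (h1 : 1 < u.length) : B.suc u ∈ B.canon :=
  mem_canon_of_seq (splits_pre_suc hu h1).2.2

theorem SucEdge.mem_right {u v : List α} (h : B.SucEdge u v) : v ∈ B.canon :=
  h.2.2 ▸ suc_mem_canon h.1 h.2.1

theorem SucEdge.append {u v : List α} (h : B.SucEdge u v) : B.pre u ++ v = u :=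
  h.2.2 ▸ pre_append_suc h.1 h.2.1

theorem SucEdge.suffix {u v : List α} (h : B.SucEdge u v) : v <:+ u := ⟨_, h.append⟩

theorem SucEdge.length_lt {u v : List α} (h : B.SucEdge u v) : v.length < u.length := by
  have h2 := List.length_pos_iff.2 (ne_nil_of_mem_canon (pre_mem_canon h.1 h.2.1))
  rw [← h.append, List.length_append]
  omega

theorem SucEdge.unique {u v w : List α} (h : B.SucEdge u v) (h' : B.SucEdge u w) : v = w :=
  h.2.2.symm.trans h'.2.2

/-- `u` is a descendant of `v` in the successor forest (possibly `v` itself). -/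
def Desc (B : BPE α) (u v : List α) : Prop := Relation.ReflTransGen B.SucEdge u v

theorem Desc.suffix {u v : List α} (h : B.Desc u v) : v <:+ u := by
  induction h with
  | refl => exact List.suffix_rfl
  | tail _ h ih => exact h.suffix.trans ih

theorem Desc.length_le {u v : List α} (h : B.Desc u v) : v.length ≤ u.length :=
  h.suffix.length_le

theorem Desc.trans {u v w : List α} (h : B.Desc u v) (h' : B.Desc v w) : B.Desc u w :=
  Relation.ReflTransGen.trans h h'

theorem Desc.mem_canon {u v : List α} (h : B.Desc u v) (hu : u ∈ B.canon) : v ∈ B.canon := by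
  induction h with
  | refl => exact hu
  | tail _ h _ => exact h.mem_right

/-- The ancestors of a token form a chain. -/
theorem Desc.total {u v w : List α} (h : B.Desc u v) (h' : B.Desc u w) :
    B.Desc v w ∨ B.Desc w v :=
  Relation.ReflTransGen.total_of_right_unique (fun _ _ _ h h' => h.unique h') h h'

theorem Desc.eq_or_suc {u v w : List α} (h : B.Desc u v) (h' : B.SucEdge u w) :
    u = v ∨ B.Desc w v := by
  rcases Relation.ReflTransGen.cases_head h with rfl | ⟨c, hc, hcv⟩
  · exact .inl rfl
  · obtain rfl := h'.unique hc
    exact .inr hcv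

theorem Desc.eq_or_child {u v : List α} (h : B.Desc u v) :
    u = v ∨ ∃ w, B.Desc u w ∧ B.SucEdge w v := by
  rcases Relation.ReflTransGen.cases_tail h with h | ⟨c, hc, hcv⟩
  · exact .inl h.symm
  · exact .inr ⟨c, hc, hcv⟩

/-- Two siblings have disjoint subtrees. -/
theorem Desc.sibling_unique {k u v w : List α} (hv : B.SucEdge v u) (hw : B.SucEdge w u)
    (hkv : B.Desc k v) (hkw : B.Desc k w) : v = w := by
  have key : ∀ {v w}, B.SucEdge v u → B.SucEdge w u → B.Desc v w → v = w := by
    intro v w hv hw h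
    rcases h.eq_or_suc hv with h | h
    · exact h
    · have := h.length_le
      have := hw.length_lt
      omega
  rcases hkv.total hkw with h | h
  · exact key hv hw h
  · exact (key hw hv h).symm

/-! ## The evolution of the last token -/

/-- The last token changes only by absorbing its left neighbour. The merged token is canonical, and
it remains to see that the merging rule is its canonical rule, so that the old last token is its
successor. -/
theorem Ends.succ {k : ℕ} {s w : List α} (h : B.Ends k s w) :
    B.Ends (k + 1) s w ∨ ∃ u, B.Ends (k + 1) s u ∧ B.SucEdge u w := by
  by_cases hk : k < B.rules.length
  swap
  · left
    unfold Ends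
    rwa [seq_succ_of_le (by omega)]
  obtain ⟨E, hE⟩ := h
  rcases mergePass_concat B.rules[k].1 B.rules[k].2 E w with ⟨F, hF⟩ | ⟨F, rfl, hw, hF⟩
  · left
    exact ⟨F, by rw [seq_succ hk, hE, hF]⟩
  · right
    have hu : B.Ends (k + 1) s (B.rules[k].1 ++ B.rules[k].2) :=
      ⟨_, by rw [seq_succ hk, hE, hF]⟩
    have h2 : 1 < (B.rules[k].1 ++ B.rules[k].2).length := by
      have h1 := List.length_pos_iff.2 (snd_ne_nil hk)
      have h2 : 0 < B.rules[k].1.length := List.length_pos_iff.2 fun h =>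
        B.nil_notMem (h ▸ (B.rules_mem _ (List.getElem_mem hk)).1)
      rw [List.length_append]
      omega
    refine ⟨_, hu, hu.mem_canon, h2, ?_⟩
    obtain ⟨e, -, -, h3⟩ := hu.decomp
    rw [List.append_assoc] at hE
    have h4 := (seq_eq_append hE).2.1
    simp only [List.cons_append, List.nil_append, List.flatten_cons, List.flatten_nil,
      List.append_nil, hw] at h4
    obtain ⟨h5, h6, h7, h8, h9, h10⟩ := canonical_rule hu.mem_canon h2
    have h11 := h10 _ h3
    -- Several rules may spell the same string. Here the string is still two tokens before round `k`
    -- and one token after it, which singles out `k`.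
    have h12 : B.ruleIdx (B.rules[k].1 ++ B.rules[k].2) = k := by
      by_contra hne
      have := seq_singleton_mono h9 (k := k) (by omega)
      rw [← h4] at this
      simp at this
    rw [← h7, hw]
    simp only [h12]

theorem Ends.desc {j k : ℕ} {s u v : List α} (hj : B.Ends j s v) (hk : B.Ends k s u)
    (hjk : j ≤ k) : B.Desc u v := by
  induction hjk generalizing u with
  | refl => rw [hj.unique hk]; exact .refl
  | @step k _ ih =>
    obtain ⟨w, hw⟩ := exists_ends (B := B) k (s := s) (by
      rintro rfl
      obtain ⟨E, hE⟩ := hj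
      simp [seq_nil] at hE)
    rcases hw.succ with h | ⟨u', h, hu'⟩
    · rw [hk.unique h]; exact ih hw
    · rw [hk.unique h]; exact .head hu' (ih hw)

theorem Ends.lastToken_desc {k : ℕ} {s u : List α} (h : B.Ends k s u) :
    B.Desc (B.lastToken s) u := by
  have hs : s ≠ [] := by
    rintro rfl
    obtain ⟨E, hE⟩ := h
    simp [seq_nil] at hE
  have h2 := (ends_iff_lastToken (B := B) hs).2 rfl
  rcases le_total k B.rules.length with hk | hk
  · exact h.desc h2 hk
  · have : B.Ends B.rules.length s u := by
      unfold Ends seq at h ⊢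
      rw [List.take_of_length_le hk] at h
      rwa [List.take_length]
    rw [(ends_iff_lastToken hs).1 this]
    exact .refl

/-- A token on the last position stays there as soon as it is formed. -/
theorem Ends.earlier {i j : ℕ} {s v : List α} (h : B.Ends j s v) (hv : B.seq i v = [v])
    (hij : i ≤ j) : B.Ends i s v := by
  obtain ⟨e, rfl, hs, -⟩ := h.decomp
  exact (hs.mono hij).ends (ends_self hv)

/-- Before a token is formed on the last position, its successor is there. -/
theorem Ends.ruleIdx {j : ℕ} {s v w : List α} (h : B.Ends j s v) (hvw : B.SucEdge v w) :
    B.ruleIdx v < j ∧ B.Ends (B.ruleIdx v + 1) s v ∧ B.Ends (B.ruleIdx v) s w := by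
  obtain ⟨h5, h6, h7, h8, h9, h10⟩ := canonical_rule hvw.1 hvw.2.1
  obtain ⟨e, rfl, hs, hj⟩ := h.decomp
  have hlt := h10 j hj
  refine ⟨hlt, h.earlier h9 (by omega), (hs.mono hlt.le).ends ⟨[B.pre v], ?_⟩⟩
  rw [h8, hvw.2.2]
  rfl

/-- Converse of `Ends.lastToken_desc`: climbing from the final token, each edge goes back to the
round in which the child was formed, just before which the parent was last. -/
theorem Desc.exists_ends {s u : List α} (hs : s ≠ []) (h : B.Desc (B.lastToken s) u) :
    ∃ k ≤ B.rules.length, B.Ends k s u := by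
  induction h with
  | refl => exact ⟨_, le_rfl, (ends_iff_lastToken hs).2 rfl⟩
  | tail _ hvw ih =>
    obtain ⟨j, hj, h⟩ := ih
    obtain ⟨h1, -, h2⟩ := h.ruleIdx hvw
    exact ⟨_, by omega, h2⟩

theorem desc_lastToken_iff {s u : List α} (hs : s ≠ []) (hu : u ∈ B.canon) (h1 : 1 < u.length) :
    B.Desc (B.lastToken s) u ↔ B.Ends (B.ruleIdx u + 1) s u := by
  refine ⟨fun h => ?_, Ends.lastToken_desc⟩
  obtain ⟨k, -, hk⟩ := h.exists_ends hs
  exact (hk.ruleIdx ⟨hu, h1, rfl⟩).2.1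

/-- A token forms at the end of a string if and only if, just before, its predecessor is not merged
to the left in the string without the successor. -/
theorem ends_append_suc_iff {s u : List α} (hu : u ∈ B.canon) (h1 : 1 < u.length) :
    B.Ends (B.ruleIdx u + 1) (s ++ B.suc u) u ↔ B.Ends (B.ruleIdx u + 1) s (B.pre u) := by
  obtain ⟨h5, h6, h7, h8, h9, h10⟩ := canonical_rule hu h1
  obtain ⟨hsp, hpre, hsuc⟩ := splits_pre_suc hu h1
  constructor
  · intro h
    obtain ⟨e, he, hs, -⟩ := h.decomp
    have hk := hs.pred
    have hse : s = e ++ B.pre u := by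
      have h : s ++ B.suc u = (e ++ B.pre u) ++ B.suc u := by
        rw [he, List.append_assoc, pre_append_suc hu h1]
      exact List.append_cancel_right h
    have hseq : B.seq (B.ruleIdx u) (s ++ B.suc u) =
        (B.seq (B.ruleIdx u) e ++ [B.pre u]) ++ [B.suc u] := by
      rw [he, hk, h8]; simp
    have hspl : B.Splits (B.ruleIdx u) s (B.suc u) := by
      have := splits_of_seq_eq_append hseq
      simpa [seq_flatten, ← hse] using this
    -- Otherwise the boundary before `suc u` survives the round, and the last token is `suc u`,
    -- which is shorter than `u`.
    by_contra hne
    have hnot : B.Splits (B.ruleIdx u + 1) s (B.suc u) := by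
      rw [hspl.succ_iff h5, h6]
      exact fun h => hne h.1
    have hend := hnot.ends (ends_self (seq_singleton_mono hsuc (Nat.le_succ _)))
    have := congrArg List.length (h.unique hend)
    have h12 : B.SucEdge u (B.suc u) := ⟨hu, h1, rfl⟩
    have := h12.length_lt
    omega
  · intro h
    have hpre_ne := ne_nil_of_mem_canon (pre_mem_canon hu h1)
    obtain ⟨e, he, hs, -⟩ := h.decomp
    -- Up to this round `s` ends exactly as `pre u` does, so a merge across this boundary would also
    -- cross the one between `pre u` and `suc u` inside `u`.
    have key : ∀ j ≤ B.ruleIdx u, B.Splits j s (B.suc u) := by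
      intro j
      induction j with
      | zero => exact fun _ => splits_zero _ _
      | succ j ih =>
        intro hj
        have hjl : j < B.rules.length := by omega
        rw [(ih (by omega)).succ_iff hjl]
        rintro ⟨h13, h14⟩
        rw [he, (hs.mono (by omega : j + 1 ≤ _)).ends_iff hpre_ne] at h13
        exact ((hsp.mono (by omega : j ≤ _)).succ_iff hjl).1 (hsp.mono hj) ⟨h13, h14⟩
    obtain ⟨E, hE⟩ := h
    refine ⟨E, ?_⟩
    have := (key _ le_rfl).merge h5 (E := E) (F := []) (by rw [hE, h6]) (by rw [hsuc, h7])
    rw [this, h6, h7, pre_append_suc hu h1]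
    rfl

/-- When the predecessor of `u` is at the end of `s` at the moment of the canonical rule of `u`. -/
theorem ends_pre_iff {s u : List α} (hs : s ≠ []) (hu : u ∈ B.canon) (h1 : 1 < u.length) :
    B.Ends (B.ruleIdx u + 1) s (B.pre u) ↔
      B.lastToken s = B.pre u ∨
      ∃ v, B.SucEdge v (B.pre u) ∧ B.Desc (B.lastToken s) v ∧ B.ruleIdx u < B.ruleIdx v := by
  obtain ⟨h5, -⟩ := canonical_rule hu h1
  obtain ⟨-, hpre, -⟩ := splits_pre_suc hu h1
  have hpre' := seq_singleton_mono hpre (Nat.le_succ _)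
  constructor
  · intro h
    rcases h.lastToken_desc.eq_or_child with h2 | ⟨v, hv, hvp⟩
    · exact .inl h2
    · refine .inr ⟨v, hvp, hv, ?_⟩
      obtain ⟨j, -, hj⟩ := hv.exists_ends hs
      obtain ⟨-, h3, -⟩ := hj.ruleIdx hvp
      -- Were `v` formed no later than this round, the last token after it would descend from `v`
      -- and could not be the shorter `pre u`. Equal indices are excluded too, as both sides refer
      -- to the state after the round.
      by_contra hlt
      have := (h3.desc h (by omega)).length_le
      have := hvp.length_lt
      omega
  · rintro (h | ⟨v, hvp, hv, hlt⟩)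
    · exact ((ends_iff_lastToken hs).2 h).earlier hpre' h5
    · obtain ⟨j, -, hj⟩ := hv.exists_ends hs
      exact (hj.ruleIdx hvp).2.2.earlier hpre' hlt

/-- The combinatorial core: ancestry of `u` for the longer string depends only on `θ(s)` and the
rule priorities among the children of `pre u`. -/
theorem desc_lastToken_append_suc_iff {s u : List α} (hs : s ≠ []) (hu : u ∈ B.canon)
    (h1 : 1 < u.length) :
    B.Desc (B.lastToken (s ++ B.suc u)) u ↔
      B.lastToken s = B.pre u ∨
      ∃ v, B.SucEdge v (B.pre u) ∧ B.Desc (B.lastToken s) v ∧ B.ruleIdx u < B.ruleIdx v := by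
  rw [desc_lastToken_iff (by simp [hs]) hu h1, ends_append_suc_iff hu h1, ends_pre_iff hs hu h1]

/-- Every token descends from its last character. -/
theorem exists_desc_atomic {u : List α} (hu : u ∈ B.canon) : ∃ c, B.Desc u [c] := by
  induction hn : u.length using Nat.strong_induction_on generalizing u with
  | _ n ih =>
    by_cases h1 : 1 < u.length
    · have h : B.SucEdge u (B.suc u) := ⟨hu, h1, rfl⟩
      obtain ⟨c, hc⟩ := ih _ (hn ▸ h.length_lt) h.mem_right rfl
      exact ⟨c, .head h hc⟩
    · have := List.length_pos_iff.2 (ne_nil_of_mem_canon hu)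
      obtain ⟨c, rfl⟩ := List.length_eq_one_iff.1 (show u.length = 1 by omega)
      exact ⟨c, .refl⟩

/-! ## The depth-first linearization -/

theorem length_le_maxLen {u : List α} (hu : u ∈ B.canon) : u.length ≤ B.maxLen :=
  Finset.le_sup (f := List.length) hu

theorem mem_childrenByPriority {u v : List α} : v ∈ B.childrenByPriority u ↔ B.SucEdge v u := by
  simp only [childrenByPriority, List.mem_filterMap, List.mem_reverse, List.mem_range]
  constructor
  · rintro ⟨k, -, h⟩
    split_ifs at h with hk
    obtain rfl := Option.some.inj h
    exact hk.2
  · intro h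
    obtain ⟨h1, h2, h3, -⟩ := canonical_rule h.1 h.2.1
    have h4 : (B.rules.getD (B.ruleIdx v) ([], [])).1 ++ (B.rules.getD (B.ruleIdx v) ([], [])).2
        = v := by
      rw [List.getD_eq_getElem _ _ h1, h2, h3, pre_append_suc h.1 h.2.1]
    refine ⟨B.ruleIdx v, h1, ?_⟩
    simp only [h4]
    simp [h]

theorem childrenByPriority_pairwise (u : List α) :
    (B.childrenByPriority u).Pairwise fun v w => B.ruleIdx w < B.ruleIdx v := by
  rw [childrenByPriority, List.pairwise_filterMap, List.pairwise_reverse]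
  refine List.pairwise_lt_range.imp ?_
  intro a b hab v hv w hw
  simp only at hv hw
  split_ifs at hv with h1
  split_ifs at hw with h2
  obtain rfl := Option.some.inj hv
  obtain rfl := Option.some.inj hw
  rw [h1.1, h2.1]
  exact hab

theorem childrenByPriority_nodup (u : List α) : (B.childrenByPriority u).Nodup :=
  (B.childrenByPriority_pairwise u).imp fun {a b} h hab => by simp [hab] at h

theorem desc_of_mem_preorderAux {f : ℕ} {u w : List α} (h : w ∈ B.preorderAux f u) :
    B.Desc w u := by
  induction f generalizing u with
  | zero =>
    obtain rfl : w = u := by simpa [preorderAux] using h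
    exact .refl
  | succ f ih =>
    rw [preorderAux, List.mem_cons, List.mem_flatMap] at h
    rcases h with rfl | ⟨v, hv, hw⟩
    · exact .refl
    · exact .tail (ih hw) (mem_childrenByPriority.1 hv)

/-- Every edge adds at least one character, so the length difference bounds the depth and hence the
fuel needed. -/
theorem mem_preorderAux_of_desc {f : ℕ} {u w : List α} (h : B.Desc w u)
    (hf : w.length ≤ f + u.length) : w ∈ B.preorderAux f u := by
  induction f generalizing u with
  | zero =>
    rcases h.eq_or_child with rfl | ⟨v, hv, hvu⟩
    · simp [preorderAux]
    · have := hv.length_le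
      have := hvu.length_lt
      omega
  | succ f ih =>
    rw [preorderAux, List.mem_cons, List.mem_flatMap]
    rcases h.eq_or_child with rfl | ⟨v, hv, hvu⟩
    · exact .inl rfl
    · have := hvu.length_lt
      exact .inr ⟨v, mem_childrenByPriority.2 hvu, ih hv (by omega)⟩

theorem mem_preorder {u w : List α} : w ∈ B.preorder u ↔ B.Desc w u := by
  refine ⟨desc_of_mem_preorderAux, fun h => ?_⟩
  refine mem_preorderAux_of_desc h ?_
  rcases Relation.ReflTransGen.cases_head h with rfl | ⟨v, hv, -⟩
  · omega
  · have := length_le_maxLen hv.1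
    omega

theorem preorderAux_succ {f : ℕ} {u : List α} (h : B.maxLen ≤ f + u.length) :
    B.preorderAux (f + 1) u = B.preorderAux f u := by
  induction f generalizing u with
  | zero =>
    have : B.childrenByPriority u = [] := by
      rw [List.eq_nil_iff_forall_not_mem]
      intro v hv
      rw [mem_childrenByPriority] at hv
      have := length_le_maxLen hv.1
      have := hv.length_lt
      omega
    simp [preorderAux, this]
  | succ f ih =>
    change u :: (B.childrenByPriority u).flatMap (B.preorderAux (f + 1)) =
      u :: (B.childrenByPriority u).flatMap (B.preorderAux f)
    congr 1
    refine List.flatMap_congr fun v hv => ih ?_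
    have := (mem_childrenByPriority.1 hv).length_lt
    omega

theorem preorder_eq (u : List α) :
    B.preorder u = u :: (B.childrenByPriority u).flatMap B.preorder := by
  rw [preorder, ← preorderAux_succ (by omega), preorderAux]
  rfl

theorem preorderAux_nodup (f : ℕ) (u : List α) : (B.preorderAux f u).Nodup := by
  induction f generalizing u with
  | zero => simp [preorderAux]
  | succ f ih =>
    rw [preorderAux, List.nodup_cons, List.nodup_flatMap]
    refine ⟨fun h => ?_, fun v _ => ih v, ?_⟩
    · obtain ⟨v, hv, hu⟩ := List.mem_flatMap.1 h
      have := (desc_of_mem_preorderAux hu).length_le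
      have := (mem_childrenByPriority.1 hv).length_lt
      omega
    · refine List.Pairwise.imp_of_mem ?_ (B.childrenByPriority_nodup u)
      intro v w hv hw hne k hkv hkw
      exact hne (Desc.sibling_unique (mem_childrenByPriority.1 hv) (mem_childrenByPriority.1 hw)
        (desc_of_mem_preorderAux hkv) (desc_of_mem_preorderAux hkw))

theorem forestOrder_nodup {order : List α} (ho : order.Nodup) : (B.forestOrder order).Nodup := by
  rw [forestOrder, List.nodup_flatMap]
  refine ⟨fun c _ => B.preorderAux_nodup _ _, ho.imp ?_⟩
  intro c d hne k hkc hkd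
  have h1 := (mem_preorder.1 hkc).suffix
  have h2 := (mem_preorder.1 hkd).suffix
  have := (List.suffix_of_suffix_length_le h1 h2 le_rfl).eq_of_length rfl
  simp at this
  exact hne this

theorem mem_forestOrder {order : List α} (ho : ∀ c, c ∈ order) {u : List α} (hu : u ∈ B.canon) :
    u ∈ B.forestOrder order := by
  obtain ⟨c, hc⟩ := exists_desc_atomic hu
  exact List.mem_flatMap.2 ⟨c, ho c, mem_preorder.2 hc⟩

theorem infix_flatMap {β γ : Type*} {l : List β} {a : β} (h : a ∈ l) (f : β → List γ) :
    f a <:+: l.flatMap f := by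
  obtain ⟨l₁, l₂, rfl⟩ := List.append_of_mem h
  exact ⟨l₁.flatMap f, l₂.flatMap f, by simp⟩

theorem Desc.preorder_infix {u v : List α} (h : B.Desc u v) :
    B.preorder u <:+: B.preorder v := by
  induction h with
  | refl => exact List.infix_rfl
  | @tail _ w _ h ih =>
    refine ih.trans ?_
    rw [B.preorder_eq w]
    exact (infix_flatMap (mem_childrenByPriority.2 h) _).trans (List.suffix_cons _ _).isInfix

theorem preorder_infix_forestOrder {order : List α} (ho : ∀ c, c ∈ order) {u : List α}
    (hu : u ∈ B.canon) : B.preorder u <:+: B.forestOrder order := by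
  obtain ⟨c, hc⟩ := exists_desc_atomic hu
  exact hc.preorder_infix.trans (infix_flatMap (ho c) fun c => B.preorder [c])

/-- Without repetitions, membership in a block is a condition on the first index. An `x` absent from
the list gets the total length as index, which is past the block, so no membership hypothesis is
needed. -/
theorem idxOf_mem_segment {β : Type*} [BEq β] [LawfulBEq β] {P Q S : List β} {x : β}
    (h : (P ++ Q ++ S).Nodup) :
    P.length ≤ (P ++ Q ++ S).idxOf x ∧ (P ++ Q ++ S).idxOf x < P.length + Q.length ↔ x ∈ Q := by
  rw [List.append_assoc] at h ⊢
  by_cases hP : x ∈ P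
  · rw [List.idxOf_append_of_mem hP]
    have h1 := List.idxOf_lt_length_iff.2 hP
    have h2 : x ∉ Q := fun hQ =>
      (List.nodup_append'.1 h).2.2 hP (List.mem_append_left _ hQ)
    exact ⟨fun h => by omega, fun h => absurd h h2⟩
  · rw [List.idxOf_append_of_notMem hP]
    by_cases hQ : x ∈ Q
    · rw [List.idxOf_append_of_mem hQ]
      have h1 := List.idxOf_lt_length_iff.2 hQ
      exact ⟨fun _ => hQ, fun _ => by omega⟩
    · rw [List.idxOf_append_of_notMem hQ]
      exact ⟨fun h => by omega, fun h => absurd h hQ⟩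

theorem dfsIn_injOn {order : List α} (ho : ∀ c, c ∈ order) {u v : List α} (hu : u ∈ B.canon)
    (h : B.dfsIn order u = B.dfsIn order v) : u = v :=
  (List.idxOf_inj (mem_forestOrder ho hu)).1 h

theorem dfsIn_eq_of_forestOrder_eq {order : List α} (ho : order.Nodup) {P S : List (List α)}
    {v : List α} (h : B.forestOrder order = P ++ v :: S) : B.dfsIn order v = P.length := by
  have hn := h ▸ B.forestOrder_nodup ho
  rw [dfsIn, h, List.idxOf_append_of_notMem, List.idxOf_cons_self, add_zero]
  intro hv
  exact (List.nodup_append'.1 hn).2.2 hv (by simp)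

/-! ## Valid intervals -/

/-- The timestamp `x` lies in the valid interval of `t`. -/
def InInterval (B : BPE α) (order t : List α) (x : ℕ) : Prop :=
  B.intervalL order t ≤ x ∧ x < B.intervalR order t

/-- Children are listed by decreasing rule index, so the first one with index at most that of `t`
separates the later rules from the rest. The interval consists of `pre t` followed by the whole
subtrees of the children before that cut. -/
theorem inInterval_iff {order : List α} (ho : order.Nodup) (ho' : ∀ c, c ∈ order) {t k : List α}
    (ht : t ∈ B.canon) (h1 : 1 < t.length) :
    B.InInterval order t (B.dfsIn order k) ↔
      k = B.pre t ∨ ∃ v, B.SucEdge v (B.pre t) ∧ B.Desc k v ∧ B.ruleIdx t < B.ruleIdx v := by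
  obtain ⟨P, S, hPS⟩ := preorder_infix_forestOrder ho' (pre_mem_canon ht h1)
  have hn := B.forestOrder_nodup ho
  have hL : B.intervalL order t = P.length := by
    rw [B.preorder_eq] at hPS
    exact dfsIn_eq_of_forestOrder_eq ho (by rw [← hPS]; simp; rfl)
  cases hf : (B.childrenByPriority (B.pre t)).find? fun u =>
      decide (B.ruleIdx u ≤ B.ruleIdx t) with
  | none =>
    have hR : B.intervalR order t = P.length + (B.preorder (B.pre t)).length := by
      rw [intervalR, hf, ← hL]; rfl
    rw [InInterval, hL, hR, dfsIn, ← hPS, idxOf_mem_segment (hPS ▸ hn), mem_preorder]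
    constructor
    · intro h
      rcases h.eq_or_child with h | ⟨v, hv, hvp⟩
      · exact .inl h
      · have := List.find?_eq_none.1 hf v (mem_childrenByPriority.2 hvp)
        exact .inr ⟨v, hvp, hv, by simpa using this⟩
    · rintro (rfl | ⟨v, hvp, hv, -⟩)
      · exact .refl
      · exact hv.tail hvp
  | some w =>
    obtain ⟨hw, A, A', hA, hA'⟩ := List.find?_eq_some_iff_append.1 hf
    have hPS' : P ++ (B.pre t :: A.flatMap B.preorder) ++
        ((w :: A').flatMap B.preorder ++ S) = B.forestOrder order := by
      rw [← hPS, B.preorder_eq (B.pre t), hA, List.flatMap_append]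
      simp
    have hR : B.intervalR order t =
        P.length + (B.pre t :: A.flatMap B.preorder).length := by
      rw [intervalR, hf, ← List.length_append]
      refine dfsIn_eq_of_forestOrder_eq ho
        (S := (B.childrenByPriority w).flatMap B.preorder ++ A'.flatMap B.preorder ++ S) ?_
      rw [← hPS', List.flatMap_cons, B.preorder_eq w]
      simp
    rw [InInterval, hL, hR, dfsIn, ← hPS', idxOf_mem_segment (hPS' ▸ hn),
      List.mem_cons, List.mem_flatMap]
    refine or_congr Iff.rfl ⟨?_, ?_⟩
    · rintro ⟨v, hv, hkv⟩
      refine ⟨v, mem_childrenByPriority.1 (by simp [hA, hv]), mem_preorder.1 hkv, ?_⟩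
      simpa using hA' v hv
    · rintro ⟨v, hvp, hkv, hlt⟩
      refine ⟨v, ?_, mem_preorder.2 hkv⟩
      have hp := B.childrenByPriority_pairwise (B.pre t)
      have hv := mem_childrenByPriority.2 hvp
      rw [hA, List.mem_append] at hv
      rw [hA, List.pairwise_append, List.pairwise_cons] at hp
      have hw' : B.ruleIdx w ≤ B.ruleIdx t := by simpa using hw
      rcases hv with hv | hv
      · exact hv
      · rcases List.mem_cons.1 hv with rfl | hv
        · omega
        · have := hp.2.1.1 v hv
          omega

/-- The interval test decides whether `t` is an ancestor of the last token. -/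
theorem inInterval_lastToken_iff {order : List α} (ho : order.Nodup) (ho' : ∀ c, c ∈ order)
    {s t : List α} (hs : s ≠ []) (ht : t ∈ B.canon) (h1 : 1 < t.length) :
    B.InInterval order t (B.dfsIn order (B.lastToken s)) ↔
      B.Desc (B.lastToken (s ++ B.suc t)) t := by
  rw [inInterval_iff ho ho' ht h1, desc_lastToken_append_suc_iff hs ht h1]

/-- Among siblings, no valid interval starts inside another one. -/
theorem not_inInterval_intervalL {order : List α} (ho : order.Nodup) (ho' : ∀ c, c ∈ order)
    {u v w : List α} (hv : B.SucEdge v u) (hw : B.SucEdge w u) (hne : v ≠ w) :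
    ¬ B.InInterval order v (B.intervalL order w) := by
  have hp := pre_mem_canon hw.1 hw.2.1
  -- The left end for `w` is the timestamp of `θ(pre w)`. Testing it against `v` therefore asks
  -- whether `v` is an ancestor of `θ(pre w ++ u)`, which is `w` itself.
  rw [intervalL, ← lastToken_of_mem_canon hp,
    inInterval_lastToken_iff ho ho' (ne_nil_of_mem_canon hp) hv.1 hv.2.1, hv.2.2, hw.append,
    lastToken_of_mem_canon hw.1]
  exact fun h => hne (Desc.sibling_unique hv hw h .refl)

theorem intervalL_injOn {order : List α} (ho : ∀ c, c ∈ order) {u v w : List α}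
    (hv : B.SucEdge v u) (hw : B.SucEdge w u)
    (h : B.intervalL order v = B.intervalL order w) : v = w := by
  have := dfsIn_injOn ho (pre_mem_canon hv.1 hv.2.1) h
  rw [← hv.append, ← hw.append, this]

/-! ## Components -/

theorem AdjIn.symm {S : Finset (List α)} {a b : List α} (h : B.AdjIn S a b) : B.AdjIn S b a :=
  ⟨h.2.1, h.1, h.2.2.symm⟩

/-- `w` can be reached from `v` inside `S`. -/
def Reach (B : BPE α) (S : Finset (List α)) (v w : List α) : Prop :=
  Relation.ReflTransGen (B.AdjIn S) v w

theorem Reach.symm {S : Finset (List α)} {a b : List α} (h : B.Reach S a b) : B.Reach S b a := by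
  induction h with
  | refl => exact .refl
  | tail _ h ih => exact .head h.symm ih

theorem Reach.trans {S : Finset (List α)} {a b c : List α} (h : B.Reach S a b)
    (h' : B.Reach S b c) : B.Reach S a c :=
  Relation.ReflTransGen.trans h h'

theorem mem_component {S : Finset (List α)} {v w : List α} :
    w ∈ B.component S v ↔ w ∈ S ∧ v ∈ S ∧ B.Reach S v w := by
  simp [component, Reach]

theorem component_subset (S : Finset (List α)) (v : List α) : B.component S v ⊆ S :=
  fun _ h => (mem_component.1 h).1

theorem component_eq_empty {S : Finset (List α)} {v : List α} (h : v ∉ S) :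
    B.component S v = ∅ := by
  ext w
  simp [mem_component, h]

/-- The subgraph induced by `K` is connected (or empty). -/
def Conn (B : BPE α) (K : Finset (List α)) : Prop := ∀ a ∈ K, ∀ b ∈ K, B.Reach K a b

theorem conn_component (S : Finset (List α)) (v : List α) : B.Conn (B.component S v) := by
  have key : ∀ w ∈ B.component S v, B.Reach (B.component S v) v w := by
    intro w hw
    obtain ⟨-, hv, hvw⟩ := mem_component.1 hw
    clear hw
    induction hvw with
    | refl => exact .refl
    | @tail a b hva hab ih =>
      exact .tail ih ⟨mem_component.2 ⟨hab.1, hv, hva⟩,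
        mem_component.2 ⟨hab.2.1, hv, .tail hva hab⟩, hab.2.2⟩
  exact fun a ha b hb => (key a ha).symm.trans (key b hb)

/-- Every node of `K` other than `u` is in the component of a neighbour of `u` in `K \ {u}`. -/
theorem Conn.exists_neighbor {K : Finset (List α)} (hK : B.Conn K) {u k : List α} (hu : u ∈ K)
    (hk : k ∈ K) (hne : k ≠ u) :
    ∃ w ∈ K.erase u, (B.SucEdge u w ∨ B.SucEdge w u) ∧ B.Reach (K.erase u) w k := by
  have key : ∀ b, B.Reach K u b → b = u ∨
      ∃ w ∈ K.erase u, (B.SucEdge u w ∨ B.SucEdge w u) ∧ B.Reach (K.erase u) w b := by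
    intro b hb
    induction hb with
    | refl => exact .inl rfl
    | @tail b c _ hbc ih =>
      by_cases hc : c = u
      · exact .inl hc
      have hc' := Finset.mem_erase.2 ⟨hc, hbc.2.1⟩
      by_cases hb : b = u
      · subst hb
        exact .inr ⟨c, hc', hbc.2.2, .refl⟩
      · obtain ⟨w, hw, h1, h2⟩ := ih.resolve_left hb
        exact .inr ⟨w, hw, h1, .tail h2 ⟨Finset.mem_erase.2 ⟨hb, hbc.1⟩, hc', hbc.2.2⟩⟩
  exact (key k (hK u hu k hk)).resolve_left hne

/-- The component of a child of `u` consists of descendants of this child. -/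
theorem Reach.desc_of_child {K : Finset (List α)} {u w k : List α} (hw : B.SucEdge w u)
    (h : B.Reach (K.erase u) w k) : B.Desc k w := by
  induction h with
  | refl => exact .refl
  | @tail a b _ hab ih =>
    rcases hab.2.2 with h | h
    · rcases ih.eq_or_suc h with rfl | h'
      · exact absurd (h.unique hw) (Finset.mem_erase.1 hab.2.1).1
      · exact h'
    · exact .head h ih

/-- The component of the parent of `u` contains no descendant of `u`. -/
theorem Reach.not_desc_of_parent {K : Finset (List α)} {u w k : List α} (hw : B.SucEdge u w)
    (h : B.Reach (K.erase u) w k) : ¬ B.Desc k u := by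
  induction h with
  | refl =>
    intro h
    have := h.length_le
    have := hw.length_lt
    omega
  | @tail a b _ hab ih =>
    intro hb
    rcases hab.2.2 with h | h
    · exact ih (.head h hb)
    · rcases hb.eq_or_suc h with rfl | h'
      · exact (Finset.mem_erase.1 hab.2.1).1 rfl
      · exact ih h'

/-- A shortest node works: a path inside `K` could leave its subtree only through its parent, which
is shorter. -/
theorem Conn.exists_top {K : Finset (List α)} (hK : B.Conn K) (hne : K.Nonempty) :
    ∃ r ∈ K, ∀ k ∈ K, B.Desc k r := by
  obtain ⟨r, hr, hmin⟩ := K.exists_min_image List.length hne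
  refine ⟨r, hr, fun k hk => ?_⟩
  have h := hK r hr k hk
  clear hk
  induction h with
  | refl => exact .refl
  | @tail a b _ hab ih =>
    rcases hab.2.2 with h | h
    · rcases ih.eq_or_suc h with rfl | h'
      · have := hmin b hab.2.1
        have := h.length_lt
        omega
      · exact h'
    · exact .head h ih

/-- Take a longest node with more than half of `K` below it. The parent's side avoids this subtree,
and each child, being longer, has at most half of `K` below it. -/
theorem Conn.exists_isCentroid {K : Finset (List α)} (hK : B.Conn K) (hne : K.Nonempty) :
    ∃ u, B.IsCentroid K u := by
  classical
  let D : List α → Finset (List α) := fun v => K.filter fun k => B.Desc k v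
  obtain ⟨r, hr, htop⟩ := hK.exists_top hne
  have hDr : D r = K := Finset.filter_true_of_mem htop
  obtain ⟨u, hu, hmax⟩ := (K.filter fun v => K.card < 2 * (D v).card).exists_max_image
    List.length ⟨r, Finset.mem_filter.2 ⟨hr, by
      rw [hDr]
      have := Finset.card_pos.2 hne
      omega⟩⟩
  obtain ⟨huK, hlt⟩ := Finset.mem_filter.1 hu
  refine ⟨u, huK, fun v hv => ?_⟩
  obtain ⟨hvu, hvK⟩ := Finset.mem_erase.1 hv
  obtain ⟨w, hw, huw, hwv⟩ := hK.exists_neighbor huK hvK hvu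
  have hwK := (Finset.mem_erase.1 hw).2
  rcases huw with huw | huw
  · have h1 : B.component (K.erase u) v ⊆ K \ D u := by
      intro k hk
      obtain ⟨hk, -, hvk⟩ := mem_component.1 hk
      refine Finset.mem_sdiff.2 ⟨(Finset.mem_erase.1 hk).2, fun h => ?_⟩
      exact (hwv.trans hvk).not_desc_of_parent huw (Finset.mem_filter.1 h).2
    have h2 := Finset.card_le_card h1
    have h3 : D u ⊆ K := Finset.filter_subset _ _
    rw [Finset.card_sdiff_of_subset h3] at h2
    omega
  · have h1 : B.component (K.erase u) v ⊆ D w := by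
      intro k hk
      obtain ⟨hk, -, hvk⟩ := mem_component.1 hk
      exact Finset.mem_filter.2 ⟨(Finset.mem_erase.1 hk).2, (hwv.trans hvk).desc_of_child huw⟩
    have h2 := Finset.card_le_card h1
    have h3 : ¬ K.card < 2 * (D w).card := fun h => by
      have := hmax w (Finset.mem_filter.2 ⟨hwK, h⟩)
      have := huw.length_lt
      omega
    omega

/-! ## Suffix-successor trees -/

theorem mem_sufSucTree {τ u : List α} : u ∈ B.sufSucTree τ ↔ u ∈ B.canon ∧ u <:+ τ := by
  simp [sufSucTree]

theorem card_sufSucTree_le (τ : List α) : (B.sufSucTree τ).card ≤ τ.length := by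
  have h : Set.MapsTo List.length (B.sufSucTree τ : Set (List α)) (Finset.Icc 1 τ.length) := by
    intro u hu
    obtain ⟨h1, h2⟩ := mem_sufSucTree.1 hu
    exact Finset.mem_coe.2 (Finset.mem_Icc.2
      ⟨List.length_pos_iff.2 (ne_nil_of_mem_canon h1), h2.length_le⟩)
  have := Finset.card_le_card_of_injOn _ h (by
    intro u hu v hv huv
    exact (List.suffix_of_suffix_length_le (mem_sufSucTree.1 hu).2 (mem_sufSucTree.1 hv).2
      huv.le).eq_of_length huv)
  simpa using this

/-- Ancestors of a suffix are again suffixes, and every node leads up to the same root, the last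
character of `τ`. -/
theorem conn_sufSucTree (τ : List α) : B.Conn (B.sufSucTree τ) := by
  have key : ∀ u ∈ B.sufSucTree τ, ∀ v, B.Desc u v → B.Reach (B.sufSucTree τ) u v := by
    intro u hu v huv
    have hmem : ∀ v, B.Desc u v → v ∈ B.sufSucTree τ := fun v hv =>
      mem_sufSucTree.2 ⟨hv.mem_canon (mem_sufSucTree.1 hu).1,
        hv.suffix.trans (mem_sufSucTree.1 hu).2⟩
    induction huv with
    | refl => exact .refl
    | tail h1 h2 ih => exact .tail ih ⟨hmem _ h1, hmem _ (.tail h1 h2), .inl h2⟩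
  intro u hu v hv
  obtain ⟨c, hc⟩ := exists_desc_atomic (mem_sufSucTree.1 hu).1
  obtain ⟨d, hd⟩ := exists_desc_atomic (mem_sufSucTree.1 hv).1
  have hcd : [c] = [d] := (List.suffix_of_suffix_length_le
    (hc.suffix.trans (mem_sufSucTree.1 hu).2) (hd.suffix.trans (mem_sufSucTree.1 hv).2)
    le_rfl).eq_of_length rfl
  exact (key u hu _ hc).trans (hcd ▸ (key v hv _ hd).symm)

/-! ## Centroid search trees -/

/-- The children of a node, sorted by their valid intervals. -/
theorem exists_sorted_children {order : List α} (ho : ∀ c, c ∈ order) (τ u : List α) :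
    ∃ (n : ℕ) (child : Fin n → List α),
      (∀ v, v ∈ Set.range child ↔ v ∈ B.sufSucTree τ ∧ B.SucEdge v u) ∧
      StrictMono fun i => B.intervalL order (child i) := by
  let C := (B.sufSucTree τ).filter fun v => B.SucEdge v u
  let S := C.image (B.intervalL order)
  have hS : ∀ i : Fin S.card, ∃ v ∈ C, B.intervalL order v = S.orderEmbOfFin rfl i := fun i =>
    Finset.mem_image.1 (S.orderEmbOfFin_mem rfl i)
  choose child h1 h2 using hS
  refine ⟨S.card, child, fun v => ⟨?_, fun hv => ?_⟩, ?_⟩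
  · rintro ⟨i, rfl⟩
    exact Finset.mem_filter.1 (h1 i)
  · have h3 : B.intervalL order v ∈ (S : Set ℕ) :=
      Finset.mem_coe.2 (Finset.mem_image_of_mem _ (Finset.mem_filter.2 hv))
    rw [← S.range_orderEmbOfFin rfl] at h3
    obtain ⟨i, hi⟩ := h3
    refine ⟨i, intervalL_injOn ho (Finset.mem_filter.1 (h1 i)).2 hv.2 ?_⟩
    rw [h2 i, hi]
  · intro i j hij
    simp only [h2]
    exact (S.orderEmbOfFin rfl).strictMono hij

theorem Conn.exists_isCST {order : List α} (ho : ∀ c, c ∈ order) (τ : List α)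
    {K : Finset (List α)} (hK : B.Conn K) : ∃ T, B.IsCST order τ T K := by
  induction hn : K.card using Nat.strong_induction_on generalizing K with
  | _ n ih =>
    rcases K.eq_empty_or_nonempty with rfl | hne
    · exact ⟨.nil, rfl⟩
    obtain ⟨u, hu⟩ := hK.exists_isCentroid hne
    have key : ∀ v, ∃ T, B.IsCST order τ T (B.component (K.erase u) v) := fun v =>
      ih _ (hn ▸ (Finset.card_le_card (B.component_subset _ v)).trans_lt
        (Finset.card_erase_lt_of_mem hu.1)) (B.conn_component _ v) rfl
    choose T hT using key
    obtain ⟨deg, child, h1, h2⟩ := B.exists_sorted_children ho τ u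
    exact ⟨.node u (T (B.suc u)) deg child fun i => T (child i), hu, hT _, h1, h2, fun i => hT _⟩

theorem exists_isCSTTable (B : BPE α) {order : List α} (ho : ∀ c, c ∈ order) :
    ∃ cst, B.IsCSTTable order cst := by
  choose T hT using fun τ => (B.conn_sufSucTree τ).exists_isCST ho τ
  exact ⟨T, fun τ _ => hT τ⟩

/-- Pointers may aim outside `K`: at a child or parent lying in another component, or at `[]` for an
atomic centroid. The component is then empty. -/
theorem IsCentroid.two_mul_card_le {K : Finset (List α)} {u : List α} (h : B.IsCentroid K u)
    (v : List α) : 2 * (B.component (K.erase u) v).card ≤ K.card := by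
  by_cases hv : v ∈ K.erase u
  · exact h.2 v hv
  · simp [component_eq_empty hv]

/-- Each pointer at least halves the component, so the exponent drops by one per level; a nonempty
component excludes exponent zero. -/
theorem IsCST.height_le {order τ : List α} {T : CST α} {K : Finset (List α)}
    (h : B.IsCST order τ T K) {n : ℕ} (hn : K.card < 2 ^ n) : T.height ≤ n := by
  induction T generalizing K n with
  | nil => simp [CST.height]
  | node u up deg child down ihu ihd =>
    obtain ⟨hu, hup, -, -, hdown⟩ := h
    cases n with
    | zero =>
      have := Finset.card_pos.2 ⟨u, hu.1⟩
      omega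
    | succ n =>
      have key : ∀ v, (B.component (K.erase u) v).card < 2 ^ n := fun v => by
        have := hu.two_mul_card_le v
        rw [pow_succ] at hn
        omega
      rw [CST.height]
      refine Nat.succ_le_succ (max_le (ihu hup (key _)) ?_)
      exact Finset.sup_le fun i _ => ihd i (hdown i) (key _)

theorem IsCST.height_le_log {order τ : List α} {T : CST α}
    (h : B.IsCST order τ T (B.sufSucTree τ)) : T.height ≤ Nat.log 2 τ.length + 1 :=
  h.height_le ((B.card_sufSucTree_le τ).trans_lt (Nat.lt_pow_succ_log_self (by norm_num) _))

end BPE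

namespace BPE

/-! ## The annotated automaton -/

/-- `w` is the longest suffix of `s` with the property `p` (`[]` if there is none). -/
def IsLongestSuffix {α : Type*} (p : List α → Prop) (s w : List α) : Prop :=
  w <:+ s ∧ (p w ∨ w = []) ∧ ∀ t, t <:+ s → p t → t <:+ w

theorem IsLongestSuffix.unique {α : Type*} {p : List α → Prop} {s v w : List α}
    (hv : IsLongestSuffix p s v) (hw : IsLongestSuffix p s w) : v = w := by
  have key : ∀ {v w}, IsLongestSuffix p s v → IsLongestSuffix p s w → v <:+ w := by
    intro v w hv hw
    rcases hv.2.1 with h | rfl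
    · exact hw.2.2 v hv.1 h
    · exact List.nil_suffix
  exact (key hv hw).eq_of_length_le (key hw hv).length_le

theorem isLongestSuffix_find? {α : Type*} (p : List α → Prop) [DecidablePred p] (s : List α) :
    IsLongestSuffix p s ((s.tails.find? fun t => decide (p t)).getD []) := by
  induction s with
  | nil =>
    by_cases h : p [] <;> simp [h, IsLongestSuffix]
  | cons a s ih =>
    rw [List.tails_cons, List.find?_cons]
    by_cases h : p (a :: s)
    · simpa [h, IsLongestSuffix] using fun t ht _ => ht
    · simp only [h, decide_false]
      refine ⟨ih.1.trans (List.suffix_cons a s), ih.2.1, fun t ht hpt => ?_⟩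
      rcases List.suffix_cons_iff.1 ht with rfl | ht
      · exact absurd hpt h
      · exact ih.2.2 t ht hpt

/-- Suffixes of an extended string. -/
theorem suffix_concat_cases {α : Type*} {t s : List α} {c : α} (h : t <:+ s ++ [c]) :
    t = [] ∨ ∃ t', t = t' ++ [c] ∧ t' <:+ s := by
  rcases List.eq_nil_or_concat t with rfl | ⟨t', d, rfl⟩
  · exact .inl rfl
  · rw [List.concat_eq_append] at h ⊢
    obtain ⟨e, he⟩ := h
    rw [← List.append_assoc] at he
    obtain ⟨h1, h2⟩ := List.append_inj' he rfl
    exact .inr ⟨t', by rw [h2], e, h1⟩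

variable {α : Type*} [DecidableEq α] {B : BPE α}

theorem IsState.of_prefix {u v : List α} (h : B.IsState v) (huv : u <+: v) : B.IsState u := by
  obtain ⟨t, ht, hvt⟩ := h
  exact ⟨t, ht, huv.trans hvt⟩

theorem isState_of_mem_canon {u : List α} (h : u ∈ B.canon) : B.IsState u :=
  ⟨u, h, List.prefix_rfl⟩

theorem isLongestSuffix_link (u : List α) : IsLongestSuffix B.IsState u.tail (B.link u) := by
  cases u with
  | nil => simp [link, IsLongestSuffix]
  | cons a u => exact isLongestSuffix_find? B.IsState u

theorem suffix_tail_of_ne {α : Type*} {t u : List α} (h : t <:+ u) (hne : t ≠ u) :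
    t <:+ u.tail := by
  cases u with
  | nil => exact h
  | cons a u => exact (List.suffix_cons_iff.1 h).resolve_left hne

/-- States are closed under prefixes. A state `t'c` with `t'` a proper suffix of `u` thus has `t'` a
state, hence a suffix of the link of `u`, and recursion on the link loses nothing. -/
theorem isLongestSuffix_delta (u : List α) (c : α) :
    IsLongestSuffix B.IsState (u ++ [c]) (B.delta u c) := by
  induction hn : u.length using Nat.strong_induction_on generalizing u with
  | _ n ih =>
    rw [delta]
    split_ifs with h1 h2
    · exact ⟨List.suffix_rfl, .inl h1, fun t ht _ => ht⟩
    · subst h2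
      refine ⟨List.nil_suffix, .inr rfl, fun t ht hpt => ?_⟩
      rcases suffix_concat_cases ht with rfl | ⟨t', rfl, ht'⟩
      · exact List.nil_suffix
      · obtain rfl := List.suffix_nil.1 ht'
        exact absurd hpt h1
    · have hl := B.isLongestSuffix_link u
      have hd := ih _ (hn ▸ B.length_link_lt h2) (B.link u) rfl
      refine ⟨hd.1.trans ?_, hd.2.1, fun t ht hpt => ?_⟩
      · exact List.suffix_append_inj_of_length_eq rfl |>.2
          ⟨hl.1.trans (List.tail_suffix u), rfl⟩
      · rcases suffix_concat_cases ht with rfl | ⟨t', rfl, ht'⟩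
        · exact List.nil_suffix
        · refine hd.2.2 _ ?_ hpt
          have hne : t' ≠ u := fun h => h1 (h ▸ hpt)
          have := hl.2.2 t' (suffix_tail_of_ne ht' hne) (hpt.of_prefix (List.prefix_append _ _))
          exact List.suffix_append_inj_of_length_eq rfl |>.2 ⟨this, rfl⟩

theorem isLongestSuffix_annot (u : List α) :
    IsLongestSuffix (· ∈ B.canon) u (B.annot u) := by
  induction hn : u.length using Nat.strong_induction_on generalizing u with
  | _ n ih =>
    rw [annot]
    split_ifs with h1 h2
    · exact ⟨List.suffix_rfl, .inl h1, fun t ht _ => ht⟩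
    · subst h2
      exact ⟨List.nil_suffix, .inr rfl, fun t ht _ => ht⟩
    · have hl := B.isLongestSuffix_link u
      have hd := ih _ (hn ▸ B.length_link_lt h2) (B.link u) rfl
      refine ⟨hd.1.trans (hl.1.trans (List.tail_suffix u)), hd.2.1, fun t ht hpt => ?_⟩
      have hne : t ≠ u := fun h => h1 (h ▸ hpt)
      exact hd.2.2 t (hl.2.2 t (suffix_tail_of_ne ht hne) (isState_of_mem_canon hpt)) hpt

theorem acState_concat (s : List α) (c : α) :
    B.acState (s ++ [c]) = B.delta (B.acState s) c := by
  simp [acState]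

theorem isLongestSuffix_acState (s : List α) : IsLongestSuffix B.IsState s (B.acState s) := by
  induction s using List.reverseRecOn with
  | nil => exact ⟨List.nil_suffix, .inr rfl, fun t ht _ => ht⟩
  | append_singleton s c ih =>
    rw [acState_concat]
    have hd := B.isLongestSuffix_delta (B.acState s) c
    refine ⟨hd.1.trans (List.suffix_append_inj_of_length_eq rfl |>.2 ⟨ih.1, rfl⟩), hd.2.1,
      fun t ht hpt => ?_⟩
    rcases suffix_concat_cases ht with rfl | ⟨t', rfl, ht'⟩
    · exact List.nil_suffix
    · exact hd.2.2 _ (List.suffix_append_inj_of_length_eq rfl |>.2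
        ⟨ih.2.2 t' ht' (hpt.of_prefix (List.prefix_append _ _)), rfl⟩) hpt

theorem isLongestSuffix_longestSuffixToken (s : List α) :
    IsLongestSuffix (· ∈ B.canon) s (B.longestSuffixToken s) :=
  isLongestSuffix_find? (· ∈ B.canon) s

/-- Canonical tokens are states, so each canonical suffix of `s` is already a suffix of the state
reached by `s`. -/
theorem annot_acState (s : List α) : B.annot (B.acState s) = B.longestSuffixToken s := by
  have h1 := B.isLongestSuffix_annot (B.acState s)
  have h2 := B.isLongestSuffix_acState s
  refine IsLongestSuffix.unique ⟨h1.1.trans h2.1, h1.2.1, fun t ht hpt => ?_⟩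
    (B.isLongestSuffix_longestSuffixToken s)
  exact h1.2.2 t (h2.2.2 t ht (isState_of_mem_canon hpt)) hpt

theorem lastToken_suffix_longestSuffixToken {s : List α} (hs : s ≠ []) :
    B.lastToken s <:+ B.longestSuffixToken s :=
  (B.isLongestSuffix_longestSuffixToken s).2.2 _ (lastToken_suffix s) (lastToken_mem_canon hs)

theorem longestSuffixToken_mem_canon {s : List α} (hs : s ≠ []) :
    B.longestSuffixToken s ∈ B.canon := by
  refine (B.isLongestSuffix_longestSuffixToken s).2.1.resolve_right fun h => ?_
  have := lastToken_suffix_longestSuffixToken (B := B) hs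
  rw [h, List.suffix_nil] at this
  exact ne_nil_of_mem_canon (lastToken_mem_canon (B := B) hs) this

/-! ## The search -/

theorem op_bind {β γ : Type*} (b : β) (f : β → Cost γ) :
    (Cost.op b).bind f = ⟨(f b).val, 1 + (f b).time⟩ := rfl

theorem bsearch_spec {n : ℕ} {key : Fin n → ℕ} (hkey : StrictMono key) (x lo hi : ℕ) (hn : hi ≤ n)
    (hle : lo ≤ hi) (hlo : ∀ i : Fin n, i < lo → key i ≤ x)
    (hhi : ∀ i : Fin n, hi ≤ i → x < key i) :
    (bsearch key x lo hi hn).val ≤ n ∧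
    (∀ i : Fin n, i < (bsearch key x lo hi hn).val → key i ≤ x) ∧
    ∀ i : Fin n, (bsearch key x lo hi hn).val ≤ i → x < key i := by
  induction hd : hi - lo using Nat.strong_induction_on generalizing lo hi with
  | _ d ih =>
    rw [bsearch]
    by_cases h : lo < hi
    · simp only [op_bind, h, dite_true, decide_eq_true_eq]
      split_ifs with hk
      · refine ih _ ?_ _ _ hn (by omega) (fun i hi => ?_) hhi rfl
        · omega
        · refine (hkey.monotone ?_).trans hk
          rw [Fin.le_def]
          simp only
          omega
      · refine ih _ ?_ _ _ _ (by omega) hlo (fun i hi => ?_) rfl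
        · omega
        · refine (not_le.1 hk).trans_le (hkey.monotone ?_)
          rw [Fin.le_def]
          exact hi
    · simp only [Cost.bind, Cost.op, h, dite_false, Cost.ret]
      obtain rfl : lo = hi := by omega
      exact ⟨hn, hlo, hhi⟩

/-- An iteration costs four steps (loop test, midpoint, key, comparison) and halves the range; the
final failed loop test is the extra one. -/
theorem bsearch_time_le {n : ℕ} (key : Fin n → ℕ) (x lo hi : ℕ) (hn : hi ≤ n) {m : ℕ}
    (hm : hi - lo < 2 ^ m) : (bsearch key x lo hi hn).time ≤ 4 * m + 1 := by
  induction m generalizing lo hi with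
  | zero =>
    rw [bsearch]
    have h : ¬ lo < hi := by omega
    simp [Cost.bind, Cost.op, Cost.ret, h]
  | succ m ih =>
    rw [bsearch]
    rw [pow_succ] at hm
    by_cases h : lo < hi
    · simp only [op_bind, h, dite_true, decide_eq_true_eq]
      split_ifs with hk
      · have := ih ((lo + hi) / 2 + 1) hi hn (by omega)
        omega
      · have := ih lo ((lo + hi) / 2) (by omega) (by omega)
        omega
    · simp [Cost.bind, Cost.op, Cost.ret, h]

theorem inInterval_val {order t : List α} {x : ℕ} :
    (B.inInterval order t x).val = true ↔ B.InInterval order t x := by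
  simp only [inInterval, op_bind]
  simp [Cost.op, InInterval]

theorem inInterval_time (order t : List α) (x : ℕ) : (B.inInterval order t x).time = 5 := rfl

theorem checkNode_val {order : List α} {H : ℕ → List α} {u : List α} :
    (B.checkNode order H u).val = true ↔
      u.length ≤ 1 ∨ B.InInterval order u (B.dfsIn order (H (B.suc u).length)) := by
  by_cases h : u.length ≤ 1
  · simp [checkNode, Cost.bind, Cost.op, Cost.ret, h]
  · simp [checkNode, Cost.bind, Cost.op, h, inInterval_val]

theorem checkNode_time_le (order : List α) (H : ℕ → List α) (u : List α) :
    (B.checkNode order H u).time ≤ 10 := by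
  by_cases h : u.length ≤ 1
  · simp [checkNode, Cost.bind, Cost.op, Cost.ret, h]
  · simp [checkNode, Cost.bind, Cost.op, h, inInterval_time]

/-- Three steps to get the timestamp, `4 * m + 1` for the binary search, and at most seven to test
the child found. -/
theorem findChild_time_le (order : List α) (H : ℕ → List α) (u : List α) {deg : ℕ}
    (child : Fin deg → List α) {m : ℕ} (hm : deg < 2 ^ m) :
    (B.findChild order H u child).time ≤ 4 * m + 11 := by
  have hb := bsearch_time_le (fun i => B.intervalL order (child i))
    (B.dfsIn order (H u.length)) 0 deg le_rfl (m := m) (by omega)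
  simp only [findChild, op_bind]
  simp only [Cost.bind]
  split_ifs <;> simp only [Cost.ret, inInterval_time] <;> omega

theorem inInterval_of_findChild {order : List α} {H : ℕ → List α} {u : List α} {deg : ℕ}
    {child : Fin deg → List α} {i : Fin deg} (h : (B.findChild order H u child).val = some i) :
    B.InInterval order (child i) (B.dfsIn order (H u.length)) := by
  simp only [findChild, op_bind] at h
  simp only [Cost.bind] at h
  split_ifs at h with h1 h2
  · obtain rfl := Option.some.inj h
    exact inInterval_val.1 h2
  · simp [Cost.ret] at h
  · simp [Cost.ret] at h

/-- Binary search finds the valid child. -/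
theorem findChild_eq_some {order : List α} {H : ℕ → List α} {u : List α} {deg : ℕ}
    {child : Fin deg → List α} (hmono : StrictMono fun i => B.intervalL order (child i))
    {i : Fin deg} (hi : B.InInterval order (child i) (B.dfsIn order (H u.length)))
    (hlast : ∀ j, i < j → B.dfsIn order (H u.length) < B.intervalL order (child j)) :
    (B.findChild order H u child).val = some i := by
  obtain ⟨h1, h2, h3⟩ := bsearch_spec hmono (B.dfsIn order (H u.length)) 0 deg le_rfl
    (Nat.zero_le _) (fun i hi => absurd hi (Nat.not_lt_zero _))
    (fun i hi => absurd i.2 (not_lt.2 hi))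
  have hj : (bsearch (fun i => B.intervalL order (child i)) (B.dfsIn order (H u.length)) 0 deg
      le_rfl).val = i + 1 := by
    apply le_antisymm
    · by_contra hlt
      push Not at hlt
      have := h2 ⟨i + 1, by omega⟩ hlt
      have := hlast ⟨i + 1, by omega⟩ (by simp [Fin.lt_def])
      omega
    · by_contra hlt
      have := h3 i (by omega)
      have := hi.1
      omega
  simp only [findChild, op_bind]
  simp only [Cost.bind, hj]
  rw [dif_pos ⟨by omega, by simp⟩]
  simp [inInterval_val.2 hi, Cost.ret]

/-- With a correct history, the interval test decides which suffixes are ancestors of the last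
token. -/
theorem inInterval_history_iff {order : List α} (ho : order.Nodup) (ho' : ∀ c, c ∈ order)
    {w : List α} {H : ℕ → List α} (hH : B.IsHistory w H) {u v : List α} (h : B.SucEdge v u)
    (hvw : v <:+ w) :
    B.InInterval order v (B.dfsIn order (H u.length)) ↔ B.Desc (B.lastToken w) v := by
  have hlt := h.length_lt
  have hle := hvw.length_le
  have hpos := List.length_pos_iff.2 (ne_nil_of_mem_canon h.mem_right)
  obtain ⟨e, he⟩ := h.suffix.trans hvw
  have hlen : e.length = w.length - u.length := by rw [← he, List.length_append]; omega
  have htake : w.take (w.length - u.length) = e := by rw [← hlen, ← he, List.take_left]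
  rw [hH u.length hpos (by omega), htake, inInterval_lastToken_iff ho ho' _ h.1 h.2.1, h.2.2, he]
  rintro rfl
  simp at hlen
  omega

/-- Induction on the search tree with the invariant that `K` is connected and contains `θ(w)`.
Connectedness puts `θ(w)` behind a neighbour of `u` inside `K`, so the pointer followed is never
null, although `child` also lists children outside `K`. -/
theorem IsCST.search_val {order : List α} (ho : order.Nodup) (ho' : ∀ c, c ∈ order)
    {w τ : List α} (hτ : τ <:+ w) {H : ℕ → List α} (hH : B.IsHistory w H) {T : CST α}
    {K : Finset (List α)} (hT : B.IsCST order τ T K) (hK : B.Conn K) (hKτ : K ⊆ B.sufSucTree τ)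
    (hw : B.lastToken w ∈ K) : (B.search order H T).val = B.lastToken w := by
  induction T generalizing K with
  | nil =>
    have hT : K = ∅ := hT
    simp [hT] at hw
  | node u up deg child down ihu ihd =>
    obtain ⟨hu, hup, hchild, hmono, hdown⟩ := hT
    have huτ := mem_sufSucTree.1 (hKτ hu.1)
    have hsub : ∀ v, B.component (K.erase u) v ⊆ B.sufSucTree τ := fun v =>
      (B.component_subset _ v).trans ((Finset.erase_subset _ _).trans hKτ)
    have hvalid : (B.checkNode order H u).val = true ↔ B.Desc (B.lastToken w) u := by
      rw [checkNode_val]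
      by_cases h1 : 1 < u.length
      · rw [inInterval_history_iff ho ho' hH ⟨huτ.1, h1, rfl⟩ (huτ.2.trans hτ)]
        exact or_iff_right (by omega)
      -- All nodes end in the same character, so an atomic centroid is the root and an ancestor of
      -- everything.
      · refine iff_of_true (.inl (by omega)) ?_
        obtain ⟨c, hc⟩ := exists_desc_atomic (mem_sufSucTree.1 (hKτ hw)).1
        have hpos := List.length_pos_iff.2 (ne_nil_of_mem_canon huτ.1)
        have : [c] = u := (List.suffix_of_suffix_length_le
          (hc.suffix.trans (mem_sufSucTree.1 (hKτ hw)).2) huτ.2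
          hpos).eq_of_length (by simp; omega)
        exact this ▸ hc
    have hcv : ∀ i, B.SucEdge (child i) u ∧
        (B.InInterval order (child i) (B.dfsIn order (H u.length)) ↔
          B.Desc (B.lastToken w) (child i)) := fun i => by
      obtain ⟨h1, h2⟩ := (hchild (child i)).1 ⟨i, rfl⟩
      exact ⟨h2, inInterval_history_iff ho ho' hH h2 ((mem_sufSucTree.1 h1).2.trans hτ)⟩
    by_cases hd : B.Desc (B.lastToken w) u
    · have hc := hvalid.2 hd
      by_cases heq : B.lastToken w = u
      · have hnone : (B.findChild order H u child).val = none := by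
          rw [Option.eq_none_iff_forall_ne_some]
          intro i hi
          have := (((hcv i).2).1 (inInterval_of_findChild hi)).length_le
          have := (hcv i).1.length_lt
          rw [heq] at *
          omega
        simp [search, Cost.bind, hc, hnone, Cost.ret, heq]
      · obtain ⟨v, hv, huv, hreach⟩ := hK.exists_neighbor hu.1 hw heq
        have huv : B.SucEdge v u := huv.resolve_left fun h => hreach.not_desc_of_parent h hd
        have hdv := hreach.desc_of_child huv
        obtain ⟨i, rfl⟩ := (hchild v).2 ⟨hKτ (Finset.mem_erase.1 hv).2, huv⟩
        have hi := ((hcv i).2).2 hdv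
        have hsome : (B.findChild order H u child).val = some i := by
          -- A later child starting at or before the timestamp would have its left end inside the
          -- interval of child `i`, which siblings do not allow.
          refine findChild_eq_some hmono hi fun j hij => ?_
          by_contra hle
          refine not_inInterval_intervalL ho ho' (hcv i).1 (hcv j).1
            (fun h => hij.ne (hmono.injective (congrArg (B.intervalL order) h))) ⟨?_, ?_⟩
          · exact (hmono hij).le
          · exact (not_lt.1 hle).trans_lt hi.2
        have := ihd i (hdown i) (B.conn_component _ _) (hsub _)
          (mem_component.2 ⟨Finset.mem_erase.2 ⟨heq, hw⟩, hv, hreach⟩)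
        simp [search, Cost.bind, hc, hsome, Cost.op, this]
    · have hc : (B.checkNode order H u).val = false := by
        rw [← Bool.not_eq_true, hvalid]
        exact hd
      have heq : B.lastToken w ≠ u := fun h => hd (h ▸ .refl)
      obtain ⟨v, hv, huv, hreach⟩ := hK.exists_neighbor hu.1 hw heq
      have huv : B.SucEdge u v := huv.resolve_right fun h =>
        hd ((hreach.desc_of_child h).tail h)
      have := ihu hup (B.conn_component _ _) (hsub _)
        (mem_component.2 ⟨Finset.mem_erase.2 ⟨heq, hw⟩, huv.2.2 ▸ hv, huv.2.2 ▸ hreach⟩)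
      simp [search, Cost.bind, hc, Cost.op, this]

/-- A level costs at most 10 steps for the validity check, `4 * m + 11` for the child search and 1
for the pointer. A node has fewer than `2 ^ m` children because they are distinct suffixes of `τ`.
-/
theorem IsCST.search_time_le {order τ : List α} {T : CST α} {K : Finset (List α)}
    (hT : B.IsCST order τ T K) (H : ℕ → List α) {m : ℕ} (hm : τ.length < 2 ^ m) :
    (B.search order H T).time ≤ T.height * (4 * m + 22) := by
  induction T generalizing K with
  | nil => simp [search, Cost.ret]
  | node u up deg child down ihu ihd =>
    obtain ⟨-, hup, hchild, hmono, hdown⟩ := hT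
    have hdeg : deg < 2 ^ m := by
      refine lt_of_le_of_lt ?_ ((B.card_sufSucTree_le τ).trans_lt hm)
      have hinj : Function.Injective child := fun i j h =>
        hmono.injective (congrArg (B.intervalL order) h)
      have := Finset.card_le_card_of_injOn (s := Finset.univ) (t := B.sufSucTree τ) child
        (fun i _ => ((hchild _).1 ⟨i, rfl⟩).1) hinj.injOn
      simpa using this
    have h1 := B.checkNode_time_le order H u
    have h2 := B.findChild_time_le order H u child hdeg
    rw [search, CST.height, add_one_mul]
    simp only [Cost.bind]
    by_cases hc : (B.checkNode order H u).val = true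
    · simp only [hc, if_true]
      cases hf : (B.findChild order H u child).val with
      | none => simp only [Cost.ret]; omega
      | some i =>
        have h3 := ihd i (hdown i)
        have h4 : (down i).height ≤ max up.height (Finset.univ.sup fun i => (down i).height) :=
          le_max_of_le_right (Finset.le_sup (f := fun i => (down i).height) (Finset.mem_univ i))
        have h5 := Nat.mul_le_mul_right (4 * m + 22) h4
        simp only [Cost.op]
        omega
    · simp only [hc, Cost.op]
      have h3 := ihu hup
      have h5 := Nat.mul_le_mul_right (4 * m + 22)
        (le_max_left up.height (Finset.univ.sup fun i => (down i).height))
      simp only [Bool.false_eq_true, if_false]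
      omega

/-! ## Updates and whole runs -/

theorem update_val {order : List α} (ho : order.Nodup) (ho' : ∀ c, c ∈ order)
    {cst : List α → CST α} (hcst : B.IsCSTTable order cst) {s : List α} {c : α} {H : ℕ → List α}
    (hH : B.IsHistory (s ++ [c]) H) :
    (B.update order cst H (B.acState s) c).val =
      (B.acState (s ++ [c]), B.lastToken (s ++ [c])) := by
  have hs : s ++ [c] ≠ [] := by simp
  have hτ := B.isLongestSuffix_longestSuffixToken (s ++ [c])
  have := (hcst _ (longestSuffixToken_mem_canon hs)).search_val ho ho' hτ.1 hH
    (B.conn_sufSucTree _) subset_rfl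
    (mem_sufSucTree.2 ⟨lastToken_mem_canon hs, lastToken_suffix_longestSuffixToken hs⟩)
  simp only [update, Cost.bind, Cost.op, Cost.ret, ← acState_concat, annot_acState, this]

theorem update_time_le {order : List α} {cst : List α → CST α} (hcst : B.IsCSTTable order cst)
    (s : List α) (c : α) (H : ℕ → List α) :
    (B.update order cst H (B.acState s) c).time ≤
      3 + (Nat.log 2 (B.longestSuffixToken (s ++ [c])).length + 1) *
        (4 * (Nat.log 2 (B.longestSuffixToken (s ++ [c])).length + 1) + 22) := by
  have hT := hcst _ (longestSuffixToken_mem_canon (B := B) (s := s ++ [c]) (by simp))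
  have h1 := hT.search_time_le H (Nat.lt_pow_succ_log_self one_lt_two _)
  have h2 := h1.trans (Nat.mul_le_mul_right _ hT.height_le_log)
  simp only [Nat.succ_eq_add_one] at h2
  simp only [update, Cost.bind, Cost.op, Cost.ret, ← acState_concat, annot_acState]
  omega

/-- With `L` the integer logarithm the count is `4L² + 30L + 29`. As `log 2 > 1/2`, `L ≤ 2l` for the
natural logarithm `l`, and `60l ≤ 30l² + 30` turns the bound `16l² + 60l + 29` into at most `46l² +
59`. -/
theorem steps_le_log_sq {n : ℕ} (hn : 0 < n) :
    ((3 + (Nat.log 2 n + 1) * (4 * (Nat.log 2 n + 1) + 22) : ℕ) : ℝ) ≤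
      59 * (1 + Real.log n ^ 2) := by
  have h1 : ((2 : ℝ) ^ Nat.log 2 n) ≤ n := by
    exact_mod_cast Nat.pow_log_le_self 2 hn.ne'
  have h2 := Real.log_le_log (by positivity) h1
  rw [Real.log_pow] at h2
  have h3 := Real.log_two_gt_d9
  have h4 : (0 : ℝ) ≤ Nat.log 2 n := Nat.cast_nonneg _
  have h5 : (Nat.log 2 n : ℝ) ≤ 2 * Real.log n := by nlinarith
  push_cast
  generalize (Nat.log 2 n : ℝ) = L at *
  generalize Real.log n = l at *
  have h6 : L ^ 2 ≤ (2 * l) ^ 2 := pow_le_pow_left₀ h4 h5 2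
  nlinarith [sq_nonneg (l - 1)]

theorem update_time_le_log_sq {order : List α} {cst : List α → CST α}
    (hcst : B.IsCSTTable order cst) (s : List α) (c : α) (H : ℕ → List α) :
    ((B.update order cst H (B.acState s) c).time : ℝ) ≤
      59 * (1 + Real.log (B.longestSuffixToken (s ++ [c])).length ^ 2) :=
  (Nat.cast_le.2 (update_time_le hcst s c H)).trans (steps_le_log_sq (List.length_pos_iff.2
    (ne_nil_of_mem_canon (longestSuffixToken_mem_canon (by simp)))))

/-- The memory content after reading `s`. -/
def memoryAfter (B : BPE α) (s : List α) : Memory α :=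
  ⟨B.acState s, (s.inits.map B.lastToken).toArray⟩

theorem isHistory_memoryAfter (s : List α) (c : α) :
    B.IsHistory (s ++ [c]) fun ℓ =>
      (B.memoryAfter s).hist.getD ((B.memoryAfter s).hist.size - ℓ) [] := by
  intro ℓ h1 h2
  simp only [List.length_append, List.length_singleton] at h2 ⊢
  -- The array also stores the empty prefix, so its size `|s| + 1` is the length of the extended
  -- string, and `size - ℓ` is the length of the prefix wanted.
  have h3 : s.length + 1 - ℓ < s.inits.length := by simp; omega
  simp only [memoryAfter, List.size_toArray, List.length_map, List.length_inits]
  rw [Array.getD_eq_getD_getElem?]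
  simp only [List.getElem?_toArray, List.getElem?_map, List.getElem?_eq_getElem h3,
    List.getElem_inits]
  rw [List.take_append_of_le_length (by omega)]
  rfl

theorem step_val {order : List α} (ho : order.Nodup) (ho' : ∀ c, c ∈ order)
    {cst : List α → CST α} (hcst : B.IsCSTTable order cst) (s : List α) (c : α) :
    (B.step order cst (B.memoryAfter s) c).val = B.memoryAfter (s ++ [c]) := by
  have h := update_val ho ho' hcst (B.isHistory_memoryAfter s c)
  set U := B.update order cst
    (fun ℓ => (B.memoryAfter s).hist.getD ((B.memoryAfter s).hist.size - ℓ) []) (B.acState s) c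
  change Memory.mk U.val.1 ((B.memoryAfter s).hist.push U.val.2) = _
  rw [h]
  simp [memoryAfter]

theorem step_time_le {order : List α} {cst : List α → CST α} (hcst : B.IsCSTTable order cst)
    (s : List α) (c : α) :
    ((B.step order cst (B.memoryAfter s) c).time : ℝ) ≤ 60 * (1 + Real.log B.maxLen ^ 2) := by
  have h := update_time_le_log_sq hcst s c fun ℓ =>
      (B.memoryAfter s).hist.getD ((B.memoryAfter s).hist.size - ℓ) []
  have hτ := longestSuffixToken_mem_canon (B := B) (s := s ++ [c]) (by simp)
  have hpos : 1 ≤ (B.longestSuffixToken (s ++ [c])).length :=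
    List.length_pos_iff.2 (ne_nil_of_mem_canon hτ)
  have h1 : Real.log (B.longestSuffixToken (s ++ [c])).length ≤ Real.log B.maxLen :=
    Real.log_le_log (by exact_mod_cast hpos) (by exact_mod_cast length_le_maxLen hτ)
  have h2 : 0 ≤ Real.log (B.longestSuffixToken (s ++ [c])).length :=
    Real.log_nonneg (by exact_mod_cast hpos)
  have h3 := pow_le_pow_left₀ h2 h1 2
  have h4 : (B.step order cst (B.memoryAfter s) c).time =
    (B.update order cst (fun ℓ => (B.memoryAfter s).hist.getD ((B.memoryAfter s).hist.size - ℓ) [])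
      (B.acState s) c).time + 1 := rfl
  rw [h4]
  push_cast
  nlinarith [sq_nonneg (Real.log B.maxLen)]

theorem runFrom_val {order : List α} (ho : order.Nodup) (ho' : ∀ c, c ∈ order)
    {cst : List α → CST α} (hcst : B.IsCSTTable order cst) (s t : List α) :
    (B.runFrom order cst (B.memoryAfter s) t).val = B.memoryAfter (s ++ t) := by
  induction t generalizing s with
  | nil => simp [runFrom, Cost.ret]
  | cons c t ih =>
    simp only [runFrom, Cost.bind, step_val ho ho' hcst, ih]
    simp

theorem runFrom_time_le {order : List α} (ho : order.Nodup) (ho' : ∀ c, c ∈ order)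
    {cst : List α → CST α} (hcst : B.IsCSTTable order cst) (s t : List α) :
    ((B.runFrom order cst (B.memoryAfter s) t).time : ℝ) ≤
      60 * (t.length * (1 + Real.log B.maxLen ^ 2)) := by
  induction t generalizing s with
  | nil => simp [runFrom, Cost.ret]
  | cons c t ih =>
    have h1 := ih (s ++ [c])
    have h2 := step_time_le hcst s c
    simp only [runFrom, Cost.bind, step_val ho ho' hcst]
    push_cast [List.length_cons]
    linarith

theorem run_eq (B : BPE α) (order : List α) (cst : List α → CST α) (s : List α) :
    B.run order cst s = B.runFrom order cst (B.memoryAfter []) s := by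
  have h : B.memoryAfter [] = ⟨[], #[[]]⟩ := by
    simp [memoryAfter, acState, lastToken, ← seq_length, seq_nil]
  rw [run, h]

end BPE

theorem mainTheorem3 :
    ∃ C : ℝ, ∀ (α : Type*) [Fintype α] [DecidableEq α] (B : BPE α)
      (order : List α), order.Nodup → (∀ c, c ∈ order) →
      (∃ cst, B.IsCSTTable order cst) ∧
      ∀ cst, B.IsCSTTable order cst →
        -- the height of the centroid search trees
        (∀ τ ∈ B.canon, (cst τ).height ≤ Nat.log 2 τ.length + 1) ∧
        -- appending one character
        (∀ (s : List α) (c : α) (H : ℕ → List α), B.IsHistory (s ++ [c]) H →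
          B.annot (B.acState (s ++ [c])) = B.longestSuffixToken (s ++ [c]) ∧
          (B.update order cst H (B.acState s) c).val =
            (B.acState (s ++ [c]), B.lastToken (s ++ [c])) ∧
          ((B.update order cst H (B.acState s) c).time : ℝ) ≤
            C * (1 + Real.log (B.longestSuffixToken (s ++ [c])).length ^ 2)) ∧
        -- processing the whole input
        (∀ s : List α,
          (B.run order cst s).val.hist.toList = s.inits.map B.lastToken ∧
          (∀ c, ((B.step order cst (B.run order cst s).val c).time : ℝ) ≤
            C * (1 + Real.log B.maxLen ^ 2)) ∧
          ((B.run order cst s).time : ℝ) ≤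
            C * (s.length * (1 + Real.log B.maxLen ^ 2))) := by
  -- 59 covers an update, and one more the append to the history.
  refine ⟨60, fun α _ _ B order ho ho' => ⟨B.exists_isCSTTable ho', fun cst hcst =>
    ⟨fun τ hτ => (hcst τ hτ).height_le_log, fun s c H hH => ⟨BPE.annot_acState _,
      BPE.update_val ho ho' hcst hH, ?_⟩, fun s => ?_⟩⟩⟩
  · have := BPE.update_time_le_log_sq hcst s c H
    nlinarith [sq_nonneg (Real.log (B.longestSuffixToken (s ++ [c])).length)]
  · rw [BPE.run_eq, BPE.runFrom_val ho ho' hcst, List.nil_append]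
    exact ⟨rfl, BPE.step_time_le hcst s, BPE.runFrom_time_le ho ho' hcst [] s⟩
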